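/- Let $n\ge 4$ be an even integer, let $u:\mathbb{R}^n\to\mathbb{R}$ be smooth, and let $g=e^{2u}|dx|^2$ be the corresponding conformal metric on $\mathbb{R}^n$ (not assumed complete). Let $R_g$ be its scalar curvature and let $Q$ be its Q-curvature, i.e. the function determined by $(-\Delta)^{n/2}u=Qe^{nu}$. Let $|\mathbb{S}^n|$ denote the volume of the standard unit $n$-sphere. Suppose that $g$ has finite total Q-curvature, that is, $Qe^{nu}\in L^1(\mathbb{R}^n)$. "Near infinity" means outside some compact set. 1. If $R_g\ge 0$ near infinity, then $$0\le\int_{\mathbb{R}^n}Qe^{nu}\,dx\le (n-1)!\,|\mathbb{S}^n|.$$ 2. If $R_g(x)\ge C|x|^{-p}$ near infinity for some constants $C>0$ and $p\ge -2$, then $$\frac{(n-1)!\,|\mathbb{S}^n|}{2}\,\max\Big\{0,\,1-\frac p2\Big\}\le\int_{\mathbb{R}^n}Qe^{nu}\,dx\le (n-1)!\,|\mathbb{S}^n|.$$ 3. If $R_g\ge 0$ near infinity, then $$\liminf_{|x|\to\infty}\frac{u(x)}{\log|x|}=-\frac{2}{(n-1)!\,|\mathbb{S}^n|}\int_{\mathbb{R}^n}Qe^{nu}\,dx.$$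 -/

import Mathlib

open MeasureTheory Filter Topology
open scoped ContDiff Nat Laplacian

noncomputable section

namespace ConformalQ

/-- Partial derivative of a real function on Euclidean space in the `i`-th coordinate direction. -/
def partialDeriv {n : ℕ} (i : Fin n) (f : EuclideanSpace ℝ (Fin n) → ℝ)
    (x : EuclideanSpace ℝ (Fin n)) : ℝ :=
  fderiv ℝ f x (EuclideanSpace.single i 1)

/-- Christoffel symbols `Γᵏᵢⱼ = ½ ∑ₗ gᵏˡ (∂ᵢ gⱼₗ + ∂ⱼ gᵢₗ - ∂ₗ gᵢⱼ)` of the metric on `ℝⁿ` with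
coefficient matrix `g`, in the standard global chart. -/
def christoffel {n : ℕ} (g : EuclideanSpace ℝ (Fin n) → Matrix (Fin n) (Fin n) ℝ)
    (k i j : Fin n) (x : EuclideanSpace ℝ (Fin n)) : ℝ :=
  (1 / 2) * ∑ l, (g x)⁻¹ k l *
    (partialDeriv i (fun y => g y j l) x + partialDeriv j (fun y => g y i l) x
      - partialDeriv l (fun y => g y i j) x)

/-- Ricci tensor
`Ricᵢⱼ = ∑ₖ (∂ₖ Γᵏᵢⱼ - ∂ⱼ Γᵏᵢₖ) + ∑ₖₗ (Γᵏₖₗ Γˡᵢⱼ - Γᵏⱼₗ Γˡᵢₖ)`. -/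
def ricci {n : ℕ} (g : EuclideanSpace ℝ (Fin n) → Matrix (Fin n) (Fin n) ℝ)
    (i j : Fin n) (x : EuclideanSpace ℝ (Fin n)) : ℝ :=
  ∑ k, (partialDeriv k (christoffel g k i j) x - partialDeriv j (christoffel g k i k) x)
    + ∑ k, ∑ l, (christoffel g k k l x * christoffel g l i j x
      - christoffel g k j l x * christoffel g l i k x)

/-- Scalar curvature `R_g = ∑ᵢⱼ gⁱʲ Ricᵢⱼ`. -/
def scalarCurvature {n : ℕ} (g : EuclideanSpace ℝ (Fin n) → Matrix (Fin n) (Fin n) ℝ)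
    (x : EuclideanSpace ℝ (Fin n)) : ℝ :=
  ∑ i, ∑ j, (g x)⁻¹ i j * ricci g i j x

/-- The conformally flat metric `g = e^{2u} |dx|²`, through its coefficients `gᵢⱼ = e^{2u} δᵢⱼ`. -/
def conformalMetric {n : ℕ} (u : EuclideanSpace ℝ (Fin n) → ℝ)
    (x : EuclideanSpace ℝ (Fin n)) : Matrix (Fin n) (Fin n) ℝ :=
  Real.exp (2 * u x) • (1 : Matrix (Fin n) (Fin n) ℝ)

/-- The integer power `(-Δ)^m` of the Euclidean (nonnegative) Laplacian. -/
def negLaplacianPow {n : ℕ} (m : ℕ) (u : EuclideanSpace ℝ (Fin n) → ℝ) :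
    EuclideanSpace ℝ (Fin n) → ℝ :=
  (fun (f : EuclideanSpace ℝ (Fin n) → ℝ) (x : EuclideanSpace ℝ (Fin n)) => -(Δ f x))^[m] u

/-- The Q-curvature of `e^{2u} |dx|²` on `ℝⁿ`, `n` even, that is the function `Q` with
`(-Δ)^{n/2} u = Q e^{nu}`. -/
def qCurvature {n : ℕ} (u : EuclideanSpace ℝ (Fin n) → ℝ)
    (x : EuclideanSpace ℝ (Fin n)) : ℝ :=
  negLaplacianPow (n / 2) u x * Real.exp (-(n * u x))

/-- The density `Q e^{nu}` of the total Q-curvature with respect to Lebesgue measure. -/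
def qDensity {n : ℕ} (u : EuclideanSpace ℝ (Fin n) → ℝ)
    (x : EuclideanSpace ℝ (Fin n)) : ℝ :=
  qCurvature u x * Real.exp (n * u x)

/-- `|𝕊ⁿ|`, the volume of the unit sphere of `ℝ^{n+1}` for its surface measure. -/
def sphereVolume (n : ℕ) : ℝ :=
  (volume : Measure (EuclideanSpace ℝ (Fin (n + 1)))).toSphere.real Set.univ

end ConformalQ

end

namespace ConformalQ

/-! ### Coordinate derivatives and Laplacians of compositions and radial functions. -/

variable {n : ℕ}

/-! Put n = 2m and α = 2 ∫ Q eⁿᵘ / ((n-1)! |𝕊ⁿ|) (`alphaQ`). Everything reduces to the growth of u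
and of its ball means, with no integral representation of u.

Means are taken against (1 - ‖y‖²)₊ᵏ. For these, differentiating in s = R² replaces u by Δu and k by
k + 1, up to a constant (`hasDerivAt_wmean_sqrt`). After m steps the integrand is (-Δ)^m u = Q eⁿᵘ,
which is integrable, so the m-th derivative of the mean in s is asymptotic to a multiple of s⁻ᵐ ∫ Q
eⁿᵘ. Integrating back, the mean is a polynomial in s plus a multiple of log s, up to o(log s). If it
grows at most logarithmically the polynomial is constant, and the mean of u over the ball of radius
R is -α log R + o(log R), after normalisation (`tendsto_wmean_div_log`).

R_g ≥ 0 says Δu + (n-2)/2 |∇u|² ≤ 0. Hence u is superharmonic near infinity, which bounds its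
centred means above. Also v = e^{(n/2-1)u} is superharmonic there, so v dominates a multiple of
‖x‖^{2-n}, that is u ≥ -2 log ‖x‖ - C (`exists_neg_two_log_le`). This is the logarithmic control
required, and comparing it with the asymptotics gives 0 ≤ α ≤ 2.

For the liminf, a bound u ≥ -β log ‖x‖ averages to α ≤ β. Conversely, u(x) is bounded below by its
mean over the ball of centre x and radius K‖x‖; for K large this is close to the centred mean,
whence u ≥ -(α + ε) log ‖x‖ (`eventually_neg_log_le`).

If R_g ≥ C‖x‖⁻ᵖ and α < 1 - p/2, the last bound makes -Δu exceed N‖x‖⁻² near infinity for every N.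
The means of u then fall faster than any multiple of the logarithm, a contradiction. -/

theorem partialDeriv_comp {g : ℝ → ℝ} {g' : ℝ} {f : EuclideanSpace ℝ (Fin n) → ℝ}
    {x : EuclideanSpace ℝ (Fin n)} (i : Fin n) (hg : HasDerivAt g g' (f x))
    (hf : DifferentiableAt ℝ f x) :
    partialDeriv i (fun y => g (f y)) x = g' * partialDeriv i f x := by
  have h := (hg.comp_hasFDerivAt x hf.hasFDerivAt).fderiv
  simp only [partialDeriv]
  rw [show (fun y => g (f y)) = g ∘ f from rfl, h]
  simp

theorem partialDeriv_mul {f g : EuclideanSpace ℝ (Fin n) → ℝ}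
    {x : EuclideanSpace ℝ (Fin n)} (i : Fin n) (hf : DifferentiableAt ℝ f x)
    (hg : DifferentiableAt ℝ g x) :
    partialDeriv i (fun y => f y * g y) x
      = f x * partialDeriv i g x + g x * partialDeriv i f x := by
  simp only [partialDeriv]
  rw [fderiv_fun_mul hf hg]
  simp

theorem partialDeriv_add {f g : EuclideanSpace ℝ (Fin n) → ℝ}
    {x : EuclideanSpace ℝ (Fin n)} (i : Fin n) (hf : DifferentiableAt ℝ f x)
    (hg : DifferentiableAt ℝ g x) :
    partialDeriv i (fun y => f y + g y) x = partialDeriv i f x + partialDeriv i g x := by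
  simp only [partialDeriv]
  rw [fderiv_fun_add hf hg]
  simp

theorem partialDeriv_sub {f g : EuclideanSpace ℝ (Fin n) → ℝ}
    {x : EuclideanSpace ℝ (Fin n)} (i : Fin n) (hf : DifferentiableAt ℝ f x)
    (hg : DifferentiableAt ℝ g x) :
    partialDeriv i (fun y => f y - g y) x = partialDeriv i f x - partialDeriv i g x := by
  simp only [partialDeriv]
  rw [fderiv_fun_sub hf hg]
  simp

theorem partialDeriv_const (i : Fin n) (c : ℝ) (x : EuclideanSpace ℝ (Fin n)) :
    partialDeriv i (fun _ => c) x = 0 := by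
  simp [partialDeriv]

theorem partialDeriv_congr {f g : EuclideanSpace ℝ (Fin n) → ℝ}
    {x : EuclideanSpace ℝ (Fin n)} (i : Fin n) (h : f =ᶠ[𝓝 x] g) :
    partialDeriv i f x = partialDeriv i g x := by
  simp only [partialDeriv, h.fderiv_eq]

theorem contDiff_two {f : EuclideanSpace ℝ (Fin n) → ℝ} (hf : ContDiff ℝ ∞ f) :
    ContDiff ℝ 2 f := by
  exact_mod_cast contDiff_infty.1 hf 2

theorem contDiff_partialDeriv {f : EuclideanSpace ℝ (Fin n) → ℝ} (hf : ContDiff ℝ ∞ f)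
    (i : Fin n) : ContDiff ℝ ∞ (partialDeriv i f) :=
  (hf.fderiv_right (m := ∞) (by simp)).clm_apply contDiff_const

theorem differentiableAt_partialDeriv {f : EuclideanSpace ℝ (Fin n) → ℝ}
    {x : EuclideanSpace ℝ (Fin n)} (hf : ContDiffAt ℝ 2 f x) (i : Fin n) :
    DifferentiableAt ℝ (partialDeriv i f) x :=
  ((hf.fderiv_right (m := 1) (by norm_num)).differentiableAt (by norm_num)).clm_apply
    (differentiableAt_const _)

theorem laplacian_eq_sum {f : EuclideanSpace ℝ (Fin n) → ℝ} {x : EuclideanSpace ℝ (Fin n)}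
    (hf : ContDiffAt ℝ 2 f x) : Δ f x = ∑ i, partialDeriv i (partialDeriv i f) x := by
  rw [InnerProductSpace.laplacian_eq_iteratedFDeriv_orthonormalBasis f
    (EuclideanSpace.basisFun (Fin n) ℝ)]
  refine Finset.sum_congr rfl fun i _ => ?_
  have h := (hf.fderiv_right (m := 1) (by norm_num)).differentiableAt (by norm_num)
  rw [iteratedFDeriv_two_apply]
  simp only [EuclideanSpace.basisFun_apply]
  change _ = fderiv ℝ (fun y => fderiv ℝ f y (EuclideanSpace.single i 1)) x _
  rw [fderiv_clm_apply h (differentiableAt_const _)]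
  simp

theorem contDiff_laplacian {f : EuclideanSpace ℝ (Fin n) → ℝ} (hf : ContDiff ℝ ∞ f) :
    ContDiff ℝ ∞ (Δ f) := by
  have : Δ f = fun x => ∑ i, partialDeriv i (partialDeriv i f) x :=
    funext fun x => laplacian_eq_sum (contDiff_two hf).contDiffAt
  rw [this]
  exact ContDiff.sum fun i _ => contDiff_partialDeriv (contDiff_partialDeriv hf i) i

/-- The Laplacian of a composition `g ∘ f` with a real function `g`. -/
theorem laplacian_comp {g g₁ : ℝ → ℝ} {g₂ : ℝ} {f : EuclideanSpace ℝ (Fin n) → ℝ}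
    {x : EuclideanSpace ℝ (Fin n)} (hf : ContDiff ℝ 2 f) (hgc : ContDiffAt ℝ 2 g (f x))
    (hg : ∀ᶠ s in 𝓝 (f x), HasDerivAt g (g₁ s) s) (hg₁ : HasDerivAt g₁ g₂ (f x)) :
    Δ (fun y => g (f y)) x
      = g₂ * ∑ i, partialDeriv i f x ^ 2 + g₁ (f x) * Δ f x := by
  rw [laplacian_eq_sum (f := fun y => g (f y)) (hgc.comp x hf.contDiffAt),
    laplacian_eq_sum hf.contDiffAt,
    Finset.mul_sum, Finset.mul_sum, ← Finset.sum_add_distrib]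
  refine Finset.sum_congr rfl fun i _ => ?_
  have hfd : Differentiable ℝ f := hf.differentiable (by norm_num)
  have h1 : partialDeriv i (fun y => g (f y)) =ᶠ[𝓝 x] fun y => g₁ (f y) * partialDeriv i f y := by
    filter_upwards [hfd.continuous.continuousAt.eventually hg] with y hy
    exact partialDeriv_comp i hy (hfd y)
  rw [partialDeriv_congr i h1, partialDeriv_mul (f := fun y => g₁ (f y)) i
    (hg₁.differentiableAt.comp x (hfd x)) (differentiableAt_partialDeriv hf.contDiffAt i),
    partialDeriv_comp i hg₁ (hfd x)]
  ring

theorem partialDeriv_norm_sq (i : Fin n) (x : EuclideanSpace ℝ (Fin n)) :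
    partialDeriv i (fun y : EuclideanSpace ℝ (Fin n) => ‖y‖ ^ 2) x = 2 * x i := by
  have h := (hasStrictFDerivAt_norm_sq x).hasFDerivAt.fderiv
  simp only [partialDeriv]
  rw [h]
  simp [EuclideanSpace.inner_single_right]

theorem laplacian_norm_sq (x : EuclideanSpace ℝ (Fin n)) :
    Δ (fun y : EuclideanSpace ℝ (Fin n) => ‖y‖ ^ 2) x = 2 * n := by
  rw [laplacian_eq_sum (contDiff_norm_sq ℝ).contDiffAt]
  have : ∀ i : Fin n,
      partialDeriv i (partialDeriv i fun y : EuclideanSpace ℝ (Fin n) => ‖y‖ ^ 2) x = 2 := by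
    intro i
    rw [show (partialDeriv i fun y : EuclideanSpace ℝ (Fin n) => ‖y‖ ^ 2) = fun y => 2 * y i from
      funext fun y => partialDeriv_norm_sq i y]
    have h : HasFDerivAt (fun y : EuclideanSpace ℝ (Fin n) => 2 * y i)
        ((2 : ℝ) • (EuclideanSpace.proj i : EuclideanSpace ℝ (Fin n) →L[ℝ] ℝ)) x :=
      (EuclideanSpace.proj i : EuclideanSpace ℝ (Fin n) →L[ℝ] ℝ).hasFDerivAt.const_mul 2
    simp [partialDeriv, h.fderiv]
  simp [this, mul_comm]

/-- The Laplacian of the radial function `g(‖x‖²)`. -/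
theorem laplacian_radial {g g₁ : ℝ → ℝ} {g₂ : ℝ} {x : EuclideanSpace ℝ (Fin n)}
    (hgc : ContDiffAt ℝ 2 g (‖x‖ ^ 2)) (hg : ∀ᶠ s in 𝓝 (‖x‖ ^ 2), HasDerivAt g (g₁ s) s)
    (hg₁ : HasDerivAt g₁ g₂ (‖x‖ ^ 2)) :
    Δ (fun y : EuclideanSpace ℝ (Fin n) => g (‖y‖ ^ 2)) x
      = 4 * ‖x‖ ^ 2 * g₂ + 2 * n * g₁ (‖x‖ ^ 2) := by
  rw [laplacian_comp (f := fun y => ‖y‖ ^ 2) (contDiff_norm_sq ℝ) hgc hg hg₁, laplacian_norm_sq]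
  simp only [partialDeriv_norm_sq, mul_pow, ← Finset.mul_sum]
  rw [EuclideanSpace.real_norm_sq_eq]
  ring

/-! ### Curvature of a conformally flat metric. -/

theorem conformalMetric_apply (u : EuclideanSpace ℝ (Fin n) → ℝ) (y : EuclideanSpace ℝ (Fin n))
    (i j : Fin n) :
    conformalMetric u y i j = if i = j then Real.exp (2 * u y) else 0 := by
  simp [conformalMetric, Matrix.one_apply]

theorem conformalMetric_inv (u : EuclideanSpace ℝ (Fin n) → ℝ) (y : EuclideanSpace ℝ (Fin n)) :
    (conformalMetric u y)⁻¹ = Real.exp (-(2 * u y)) • (1 : Matrix (Fin n) (Fin n) ℝ) := by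
  apply Matrix.inv_eq_left_inv
  simp [conformalMetric, smul_smul, ← Real.exp_add]

theorem partialDeriv_conformalMetric {u : EuclideanSpace ℝ (Fin n) → ℝ} (hu : ContDiff ℝ ∞ u)
    (k i j : Fin n) (x : EuclideanSpace ℝ (Fin n)) :
    partialDeriv k (fun y => conformalMetric u y i j) x
      = if i = j then Real.exp (2 * u x) * (2 * partialDeriv k u x) else 0 := by
  simp only [conformalMetric_apply]
  split_ifs with h
  · have hd : HasDerivAt (fun s : ℝ => Real.exp (2 * s)) (Real.exp (2 * u x) * 2) (u x) := by
      simpa using ((hasDerivAt_id (u x)).const_mul 2).exp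
    rw [partialDeriv_comp (g := fun s => Real.exp (2 * s)) k hd
      (hu.differentiable (by simp) x)]
    ring
  · exact partialDeriv_const k 0 x

theorem christoffel_conformalMetric {u : EuclideanSpace ℝ (Fin n) → ℝ} (hu : ContDiff ℝ ∞ u)
    (k i j : Fin n) (x : EuclideanSpace ℝ (Fin n)) :
    christoffel (conformalMetric u) k i j x
      = (if j = k then 1 else 0) * partialDeriv i u x
        + (if i = k then 1 else 0) * partialDeriv j u x
        - (if i = j then 1 else 0) * partialDeriv k u x := by
  simp only [christoffel, partialDeriv_conformalMetric hu, conformalMetric_inv, Matrix.smul_apply,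
    Matrix.one_apply, smul_eq_mul, mul_ite, mul_one, mul_zero, ite_mul, zero_mul,
    Finset.sum_ite_eq, Finset.mem_univ, if_true, Real.exp_neg]
  split_ifs <;> field_simp <;> ring

theorem partialDeriv_christoffel_conformalMetric {u : EuclideanSpace ℝ (Fin n) → ℝ}
    (hu : ContDiff ℝ ∞ u) (m k i j : Fin n) (x : EuclideanSpace ℝ (Fin n)) :
    partialDeriv m (christoffel (conformalMetric u) k i j) x
      = (if j = k then 1 else 0) * partialDeriv m (partialDeriv i u) x
        + (if i = k then 1 else 0) * partialDeriv m (partialDeriv j u) x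
        - (if i = j then 1 else 0) * partialDeriv m (partialDeriv k u) x := by
  have hd : ∀ l, DifferentiableAt ℝ (partialDeriv l u) x := fun l =>
    (contDiff_partialDeriv hu l).differentiable (by simp) x
  have hc : ∀ (c : ℝ) (l : Fin n), partialDeriv m (fun y => c * partialDeriv l u y) x
      = c * partialDeriv m (partialDeriv l u) x := fun c l => by
    rw [partialDeriv_mul m (differentiableAt_const c) (hd l), partialDeriv_const]
    ring
  rw [show christoffel (conformalMetric u) k i j = _ from
    funext fun y => christoffel_conformalMetric hu k i j y,
    partialDeriv_sub m (((hd i).const_mul _).fun_add ((hd j).const_mul _)) ((hd k).const_mul _),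
    partialDeriv_add m ((hd i).const_mul _) ((hd j).const_mul _), hc, hc, hc]

/-- The diagonal of the classical conformal change formula. The off-diagonal entries are not needed,
because the inverse metric is diagonal. -/
theorem ricci_conformalMetric_self {u : EuclideanSpace ℝ (Fin n) → ℝ}
    (hu : ContDiff ℝ ∞ u) (i : Fin n) (x : EuclideanSpace ℝ (Fin n)) :
    ricci (conformalMetric u) i i x
      = (2 - n) * partialDeriv i (partialDeriv i u) x - Δ u x
        + (n - 2) * partialDeriv i u x ^ 2 - (n - 2) * ∑ k, partialDeriv k u x ^ 2 := by
  rw [laplacian_eq_sum (contDiff_two hu).contDiffAt]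
  simp only [ricci, partialDeriv_christoffel_conformalMetric hu, christoffel_conformalMetric hu]
  set a : Fin n → ℝ := fun k => partialDeriv k u x with ha
  simp only [show ∀ k, partialDeriv k u x = a k from fun _ => rfl]
  -- Products of Kronecker deltas are rewritten as separate indicators, so that each term of the
  -- double sum evaluates on its own.
  have h1 : ∀ k l : Fin n, (((if l = k then 1 else 0) * a k + (if True then 1 else 0) * a l
      - (if k = l then 1 else 0) * a k) * ((if i = l then 1 else 0) * a i +
      (if i = l then 1 else 0) * a i - (if True then 1 else 0) * a l)
      - ((if l = k then 1 else 0) * a i + (if i = k then 1 else 0) * a l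
      - (if i = l then 1 else 0) * a k) * ((if k = l then 1 else 0) * a i +
      (if i = l then 1 else 0) * a k - (if i = k then 1 else 0) * a l))
      = (if i = l then 2 * a l * a i else 0) - a l ^ 2 - (if k = l then a i ^ 2 else 0)
       + (if i = k then a l ^ 2 else 0) + (if i = l then a k ^ 2 else 0)
       - (if i = k then (if i = l then 2 * a i ^ 2 else 0) else 0) := by
    intro k l
    by_cases hk : i = k <;> by_cases hl : i = l <;> by_cases hkl : k = l <;> subst_vars <;>
      simp_all [eq_comm] <;> ring
  simp only [h1]
  have h2 : ∀ k : Fin n, ((if i = k then 1 else 0) * partialDeriv k (partialDeriv i u) x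
      + (if i = k then 1 else 0) * partialDeriv k (partialDeriv i u) x
      - (if True then 1 else 0) * partialDeriv k (partialDeriv k u) x
      - ((if True then 1 else 0) * partialDeriv i (partialDeriv i u) x
      + (if i = k then 1 else 0) * partialDeriv i (partialDeriv k u) x
      - (if i = k then 1 else 0) * partialDeriv i (partialDeriv k u) x))
      = (if i = k then 2 * partialDeriv k (partialDeriv i u) x else 0)
        - partialDeriv k (partialDeriv k u) x - partialDeriv i (partialDeriv i u) x := by
    intro k
    split_ifs
    · simp
      ring
    · simp
  simp only [h2]
  simp only [Finset.sum_add_distrib, Finset.sum_sub_distrib, Finset.sum_ite_eq, Finset.mem_univ,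
    if_true, Finset.sum_const, Finset.card_univ, Fintype.card_fin, nsmul_eq_mul,
    Finset.sum_ite_irrel]
  simp only [mul_zero, Finset.sum_ite_eq, Finset.mem_univ, if_true]
  ring

/-- The scalar curvature of `e^{2u}|dx|²`. -/
theorem scalarCurvature_conformalMetric {u : EuclideanSpace ℝ (Fin n) → ℝ}
    (hu : ContDiff ℝ ∞ u) (x : EuclideanSpace ℝ (Fin n)) :
    scalarCurvature (conformalMetric u) x
      = (n - 1) * Real.exp (-(2 * u x))
        * (-(2 * Δ u x) - (n - 2) * ∑ k, partialDeriv k u x ^ 2) := by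
  simp only [scalarCurvature, conformalMetric_inv, Matrix.smul_apply,
    Matrix.one_apply, smul_eq_mul, mul_ite, mul_one, mul_zero, ite_mul, zero_mul,
    Finset.sum_ite_eq, Finset.mem_univ, if_true, ricci_conformalMetric_self hu]
  rw [← Finset.mul_sum]
  simp only [Finset.sum_add_distrib, Finset.sum_sub_distrib, ← Finset.mul_sum, Finset.sum_const,
    Finset.card_univ, Fintype.card_fin, nsmul_eq_mul]
  rw [← laplacian_eq_sum (contDiff_two hu).contDiffAt]
  ring

/-! ### Second-order condition at a minimum. -/

/-- The Laplacian is nonnegative at a local minimum. -/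
theorem laplacian_nonneg_of_isLocalMin {f : EuclideanSpace ℝ (Fin n) → ℝ}
    {x : EuclideanSpace ℝ (Fin n)} (hf : ContDiffAt ℝ 2 f x) (hmin : IsLocalMin f x) :
    0 ≤ Δ f x := by
  rw [laplacian_eq_sum hf]
  refine Finset.sum_nonneg fun i _ => ?_
  set e : EuclideanSpace ℝ (Fin n) := EuclideanSpace.single i 1
  have hline : Continuous fun t : ℝ => x + t • e := by fun_prop
  have ht : Tendsto (fun t : ℝ => x + t • e) (𝓝 0) (𝓝 x) := by
    simpa using hline.tendsto 0
  have hline' : ∀ t : ℝ, HasDerivAt (fun t : ℝ => x + t • e) e t := fun t => by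
    simpa using ((hasDerivAt_id t).smul_const e).const_add x
  set g : ℝ → ℝ := fun t => f (x + t • e)
  have hg1 : ∀ᶠ t in 𝓝 (0 : ℝ), HasDerivAt g (partialDeriv i f (x + t • e)) t := by
    filter_upwards [ht.eventually (hf.eventually (by simp))] with t h
    exact (h.differentiableAt (by norm_num)).hasFDerivAt.comp_hasDerivAt t (hline' t)
  have hg2 : HasDerivAt (fun t : ℝ => partialDeriv i f (x + t • e))
      (partialDeriv i (partialDeriv i f) x) 0 := by
    have := (differentiableAt_partialDeriv hf i).hasFDerivAt
    exact HasFDerivAt.comp_hasDerivAt_of_eq (x := (0 : ℝ)) this (hline' 0) (by simp)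
  have hd1 : deriv g =ᶠ[𝓝 0] fun t => partialDeriv i f (x + t • e) :=
    hg1.mono fun t h => h.deriv
  have hd2 : deriv (deriv g) 0 = partialDeriv i (partialDeriv i f) x := by
    rw [hd1.deriv_eq, hg2.deriv]
  have hgmin : IsLocalMin g 0 := by
    have := ht.eventually hmin
    simpa [IsLocalMin, IsMinFilter, g] using this
  by_contra hneg
  push Not at hneg
  -- A negative second derivative would make 0 a local maximum as well, hence g locally constant
  -- with zero second derivative.
  have hmax : IsLocalMax g 0 := isLocalMax_of_deriv_deriv_neg (hd2 ▸ hneg) hgmin.deriv_eq_zero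
    hg1.self_of_nhds.continuousAt
  have hconst : g =ᶠ[𝓝 0] fun _ => g 0 := by
    filter_upwards [hgmin, hmax] with t h1 h2 using le_antisymm h2 h1
  have h0 : deriv (deriv g) 0 = 0 := by
    rw [hconst.deriv.deriv_eq]
    simp
  rw [hd2] at h0
  exact hneg.ne h0

/-! ### Weighted ball means and their derivative in the radius. -/

theorem hasDerivAt_max_zero_pow {k : ℕ} (hk : 1 ≤ k) (t : ℝ) :
    HasDerivAt (fun s : ℝ => max 0 s ^ (k + 1)) ((k + 1) * max 0 t ^ k) t := by
  rcases lt_trichotomy t 0 with ht | rfl | ht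
  · have h : (fun s : ℝ => max 0 s ^ (k + 1)) =ᶠ[𝓝 t] fun _ => 0 := by
      filter_upwards [Iio_mem_nhds ht] with s hs
      rw [max_eq_left (le_of_lt hs), zero_pow (by omega)]
    rw [max_eq_left ht.le, zero_pow (by omega), mul_zero]
    exact (hasDerivAt_const t (0 : ℝ)).congr_of_eventuallyEq h
  · rw [max_self, zero_pow (by omega), mul_zero, hasDerivAt_iff_tendsto]
    have h : Tendsto (fun s : ℝ => |s| ^ k) (𝓝 0) (𝓝 0) := by
      have : Continuous fun s : ℝ => |s| ^ k := by fun_prop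
      simpa [show k ≠ 0 by omega] using this.tendsto 0
    refine squeeze_zero (fun s => by positivity) (fun s => ?_) h
    simp only [sub_zero, max_self, smul_zero, Real.norm_eq_abs, ne_eq, Nat.add_eq_zero_iff,
      one_ne_zero, and_false, not_false_eq_true, zero_pow, abs_pow]
    have h1 : |max 0 s| ≤ |s| := by
      rw [abs_of_nonneg (le_max_left _ _)]
      exact max_le (abs_nonneg _) (le_abs_self _)
    rcases eq_or_ne s 0 with rfl | hs
    · simp [show k ≠ 0 by omega]
    · calc |s|⁻¹ * |max 0 s| ^ (k + 1) ≤ |s|⁻¹ * |s| ^ (k + 1) := by gcongr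
        _ = |s| ^ k := by
          rw [pow_succ', inv_mul_cancel_left₀ (abs_pos.2 hs).ne']
  · have h : (fun s : ℝ => max 0 s ^ (k + 1)) =ᶠ[𝓝 t] fun s => s ^ (k + 1) := by
      filter_upwards [Ioi_mem_nhds ht] with s hs
      rw [max_eq_right (le_of_lt hs)]
    rw [max_eq_right ht.le]
    simpa using (hasDerivAt_pow (k + 1) t).congr_of_eventuallyEq h

/-- The radial weight `(1 - ‖y‖²)₊ᵏ`. -/
noncomputable def weight (k : ℕ) (y : EuclideanSpace ℝ (Fin n)) : ℝ :=
  max 0 (1 - ‖y‖ ^ 2) ^ k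

theorem continuous_weight (k : ℕ) :
    Continuous (weight k : EuclideanSpace ℝ (Fin n) → ℝ) := by
  unfold weight
  fun_prop

theorem weight_nonneg (k : ℕ) (y : EuclideanSpace ℝ (Fin n)) : 0 ≤ weight k y :=
  pow_nonneg (le_max_left _ _) _

theorem weight_le_one (k : ℕ) (y : EuclideanSpace ℝ (Fin n)) : weight k y ≤ 1 :=
  pow_le_one₀ (le_max_left _ _) (max_le zero_le_one (by nlinarith [norm_nonneg y]))

theorem weight_eq_zero {k : ℕ} (hk : 1 ≤ k) {y : EuclideanSpace ℝ (Fin n)} (hy : 1 ≤ ‖y‖) :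
    weight k y = 0 := by
  rw [weight, max_eq_left (by nlinarith), zero_pow (by omega)]

theorem hasCompactSupport_weight {k : ℕ} (hk : 1 ≤ k) :
    HasCompactSupport (weight k : EuclideanSpace ℝ (Fin n) → ℝ) :=
  HasCompactSupport.intro (isCompact_closedBall 0 1) fun y hy =>
    weight_eq_zero hk (by simpa using (not_le.1 (mt mem_closedBall_zero_iff.2 hy)).le)

theorem hasFDerivAt_weight {k : ℕ} (hk : 1 ≤ k) (y : EuclideanSpace ℝ (Fin n)) :
    HasFDerivAt (weight (k + 1)) ((-(2 * (k + 1) * weight k y)) • innerSL ℝ y) y := by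
  have h := (hasDerivAt_max_zero_pow hk (1 - ‖y‖ ^ 2)).comp_hasFDerivAt y
    ((hasStrictFDerivAt_norm_sq y).hasFDerivAt.const_sub 1)
  refine h.congr_fderiv ?_
  ext v
  simp [weight]
  ring

theorem integrable_mul_weight {k : ℕ} (hk : 1 ≤ k) {f : EuclideanSpace ℝ (Fin n) → ℝ}
    (hf : Continuous f) : Integrable (fun y => f y * weight k y) :=
  (hf.mul (continuous_weight k)).integrable_of_hasCompactSupport
    ((hasCompactSupport_weight hk).mul_left)

theorem integrable_weight {k : ℕ} (hk : 1 ≤ k) :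
    Integrable (weight k : EuclideanSpace ℝ (Fin n) → ℝ) :=
  (continuous_weight k).integrable_of_hasCompactSupport (hasCompactSupport_weight hk)

/-- The weighted mean (not normalised) of `f` over the ball of centre `x` and radius `R`. -/
noncomputable def wmean (k : ℕ) (f : EuclideanSpace ℝ (Fin n) → ℝ)
    (x : EuclideanSpace ℝ (Fin n)) (R : ℝ) : ℝ :=
  ∫ y, f (x + R • y) * weight k y

theorem integrable_wmean {k : ℕ} (hk : 1 ≤ k) {f : EuclideanSpace ℝ (Fin n) → ℝ}
    (hf : Continuous f) (x : EuclideanSpace ℝ (Fin n)) (R : ℝ) :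
    Integrable (fun y => f (x + R • y) * weight k y) :=
  integrable_mul_weight hk (f := fun y => f (x + R • y)) (by fun_prop)

/-- Since y (1 - ‖y‖²)₊ᵏ = -∇(1 - ‖y‖²)₊ᵏ⁺¹ / (2(k+1)), one integration by parts turns the radial
derivative into the Laplacian. The factor R comes from the chain rule. -/
theorem integral_fderiv_mul_weight {k : ℕ} (hk : 1 ≤ k) {f : EuclideanSpace ℝ (Fin n) → ℝ}
    (hf : ContDiff ℝ ∞ f) (x : EuclideanSpace ℝ (Fin n)) (R : ℝ) :
    ∫ y, fderiv ℝ f (x + R • y) y * weight k y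
      = R / (2 * (k + 1)) * wmean (k + 1) (Δ f) x R := by
  have hcoord : ∀ y, fderiv ℝ f (x + R • y) y * weight k y
      = ∑ i, partialDeriv i f (x + R • y) * (y i * weight k y) := by
    intro y
    have hy : y = ∑ i, y i • EuclideanSpace.single i (1 : ℝ) := by
      ext j
      simp [Pi.single_apply]
    conv_lhs => enter [1, 2]; rw [hy]
    rw [map_sum, Finset.sum_mul]
    refine Finset.sum_congr rfl fun i _ => ?_
    simp only [map_smul, smul_eq_mul, partialDeriv]
    ring
  have hpc : ∀ i, Continuous fun y => partialDeriv i f (x + R • y) := fun i =>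
    (contDiff_partialDeriv hf i).continuous.comp (by fun_prop)
  have hppc : ∀ i, Continuous fun y => partialDeriv i (partialDeriv i f) (x + R • y) := fun i =>
    (contDiff_partialDeriv (contDiff_partialDeriv hf i) i).continuous.comp (by fun_prop)
  have hint : ∀ i, Integrable fun y : EuclideanSpace ℝ (Fin n) =>
      partialDeriv i f (x + R • y) * (y i * weight k y) := fun i => by
    have h := integrable_mul_weight hk (f := fun y => partialDeriv i f (x + R • y) * y i)
      ((hpc i).mul (by fun_prop))
    simpa only [mul_assoc] using h
  have hk0 : (2 * ((k : ℝ) + 1)) ≠ 0 := by positivity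
  have hw : ∀ (i : Fin n) (y : EuclideanSpace ℝ (Fin n)),
      fderiv ℝ (weight (k + 1)) y (EuclideanSpace.single i 1)
        = -(2 * (k + 1)) * (y i * weight k y) := fun i y => by
    rw [(hasFDerivAt_weight hk y).fderiv]
    simp [EuclideanSpace.inner_single_right]
    ring
  have hF : ∀ (i : Fin n) (y : EuclideanSpace ℝ (Fin n)),
      HasFDerivAt (fun y => partialDeriv i f (x + R • y))
        (R • fderiv ℝ (partialDeriv i f) (x + R • y)) y := fun i y => by
    have h1 := ((contDiff_partialDeriv hf i).differentiable (by simp) (x + R • y)).hasFDerivAt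
    have h2 : HasFDerivAt (fun y : EuclideanSpace ℝ (Fin n) => x + R • y)
        (R • ContinuousLinearMap.id ℝ (EuclideanSpace ℝ (Fin n))) y :=
      ((hasFDerivAt_id y).const_smul R).const_add x
    refine (h1.comp y h2).congr_fderiv ?_
    ext v
    simp
  have hparts : ∀ i : Fin n, ∫ y : EuclideanSpace ℝ (Fin n),
      partialDeriv i f (x + R • y) * (y i * weight k y)
        = R / (2 * (k + 1)) * ∫ y, partialDeriv i (partialDeriv i f) (x + R • y)
          * weight (k + 1) y := fun i => by
    have h := integral_mul_fderiv_eq_neg_fderiv_mul_of_integrable (μ := volume)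
      (f := fun y => partialDeriv i f (x + R • y)) (g := weight (k + 1))
      (v := EuclideanSpace.single i (1 : ℝ)) ?_ ?_ ?_ ?_ ?_
    · simp only [hw, (hF _ _).fderiv] at h
      have e1 : ∀ y : EuclideanSpace ℝ (Fin n), partialDeriv i f (x + R • y)
          * (-(2 * (k + 1)) * (y i * weight k y)) = -(2 * (k + 1)) *
            (partialDeriv i f (x + R • y) * (y i * weight k y)) := fun y => by ring
      have e2 : ∀ y : EuclideanSpace ℝ (Fin n),
          (R • fderiv ℝ (partialDeriv i f) (x + R • y)) (EuclideanSpace.single i 1)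
            * weight (k + 1) y
          = R * (partialDeriv i (partialDeriv i f) (x + R • y) * weight (k + 1) y) := fun y => by
        simp only [_root_.smul_apply, smul_eq_mul, partialDeriv]
        ring
      simp only [e1, e2, integral_const_mul] at h
      rw [div_mul_eq_mul_div, eq_div_iff hk0]
      linear_combination (-1 : ℝ) * h
    · simp only [(hF _ _).fderiv]
      exact integrable_mul_weight (by omega) ((hppc i).const_smul R)
    · simp only [hw]
      refine ((hint i).const_mul (-(2 * (k + 1)))).congr (ae_of_all _ fun y => ?_)
      ring
    · exact integrable_mul_weight (by omega) (hpc i)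
    · exact fun y _ => (hF i y).differentiableAt
    · exact fun y _ => (hasFDerivAt_weight hk y).differentiableAt
  simp only [hcoord]
  rw [integral_finsetSum _ fun i _ => hint i]
  simp only [hparts]
  rw [← Finset.mul_sum, ← integral_finsetSum _ fun i _ =>
    integrable_mul_weight (by omega) (hppc i)]
  simp only [wmean, laplacian_eq_sum (contDiff_two hf).contDiffAt, Finset.sum_mul]

/-- Differentiation under the integral sign, then `integral_fderiv_mul_weight`. The family of
weights is closed under this operation, so the identity can be iterated without boundary terms. -/
theorem hasDerivAt_wmean {k : ℕ} (hk : 1 ≤ k) {f : EuclideanSpace ℝ (Fin n) → ℝ}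
    (hf : ContDiff ℝ ∞ f) (x : EuclideanSpace ℝ (Fin n)) (R : ℝ) :
    HasDerivAt (wmean k f x) (R / (2 * (k + 1)) * wmean (k + 1) (Δ f) x R) R := by
  rw [← integral_fderiv_mul_weight hk hf]
  have hfd : Continuous (fderiv ℝ f) := hf.continuous_fderiv (by simp)
  -- For r within 1 of R and y in the support of the weight, x + r • y stays in this ball, so C
  -- times the weight dominates.
  obtain ⟨C, hC⟩ := (isCompact_closedBall x (|R| + 1)).exists_bound_of_continuousOn
    hfd.continuousOn
  have h := hasDerivAt_integral_of_dominated_loc_of_deriv_le (μ := volume)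
    (s := Metric.ball R 1) (x₀ := R) (bound := fun y => C * weight k y)
    (F := fun r y => f (x + r • y) * weight k y)
    (F' := fun r y => fderiv ℝ f (x + r • y) y * weight k y)
    (Metric.ball_mem_nhds R one_pos)
    (Eventually.of_forall fun r => (integrable_wmean hk hf.continuous x r).aestronglyMeasurable)
    (integrable_wmean hk hf.continuous x R) ?_ ?_ ((integrable_weight hk).const_mul C) ?_
  · exact h.2
  · refine Continuous.aestronglyMeasurable ?_
    exact ((hfd.comp (by fun_prop)).clm_apply continuous_id).mul (continuous_weight k)
  · refine ae_of_all _ fun y r hr => ?_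
    rcases le_or_gt 1 ‖y‖ with hy | hy
    · simp [weight_eq_zero hk hy]
    · rw [norm_mul, Real.norm_of_nonneg (weight_nonneg k y)]
      refine mul_le_mul_of_nonneg_right ?_ (weight_nonneg k y)
      have hmem : x + r • y ∈ Metric.closedBall x (|R| + 1) := by
        rw [mem_closedBall_iff_norm, add_sub_cancel_left, norm_smul, Real.norm_eq_abs]
        have : |r| ≤ |R| + 1 := by
          have := abs_sub_abs_le_abs_sub r R
          rw [Metric.mem_ball, Real.dist_eq] at hr
          linarith
        nlinarith [abs_nonneg r, norm_nonneg y]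
      have hCn := hC _ hmem
      calc ‖fderiv ℝ f (x + r • y) y‖ ≤ ‖fderiv ℝ f (x + r • y)‖ * ‖y‖ :=
            ContinuousLinearMap.le_opNorm _ _
        _ ≤ C * 1 := mul_le_mul hCn hy.le (norm_nonneg _) ((norm_nonneg _).trans hCn)
        _ = C := mul_one C
  · refine ae_of_all _ fun y r _ => ?_
    have h1 := (hf.differentiable (by simp) (x + r • y)).hasFDerivAt
    have h2 : HasDerivAt (fun r : ℝ => x + r • y) y r := by
      simpa using ((hasDerivAt_id r).smul_const y).const_add x
    exact (h1.comp_hasDerivAt r h2).mul_const _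

/-- The total mass of the weight `(1 - ‖y‖²)₊`. -/
noncomputable def weightMass (n : ℕ) : ℝ := ∫ y : EuclideanSpace ℝ (Fin n), weight 1 y

theorem wmean_zero (f : EuclideanSpace ℝ (Fin n) → ℝ) (x : EuclideanSpace ℝ (Fin n)) :
    wmean 1 f x 0 = f x * weightMass n := by
  simp [wmean, weightMass, integral_const_mul]

/-- Mean value inequality for smooth superharmonic functions. -/
theorem wmean_le_of_laplacian_nonpos {f : EuclideanSpace ℝ (Fin n) → ℝ}
    (hf : ContDiff ℝ ∞ f) (hΔ : ∀ x, Δ f x ≤ 0) (x : EuclideanSpace ℝ (Fin n)) {R : ℝ}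
    (hR : 0 ≤ R) : wmean 1 f x R ≤ f x * weightMass n := by
  have hanti : AntitoneOn (wmean 1 f x) (Set.Ici 0) := by
    refine antitoneOn_of_deriv_nonpos (convex_Ici 0)
      (fun r _ => (hasDerivAt_wmean le_rfl hf x r).continuousAt.continuousWithinAt)
      (fun r _ => (hasDerivAt_wmean le_rfl hf x r).differentiableAt.differentiableWithinAt)
      fun r hr => ?_
    rw [interior_Ici, Set.mem_Ioi] at hr
    rw [(hasDerivAt_wmean le_rfl hf x r).deriv]
    refine mul_nonpos_of_nonneg_of_nonpos (by positivity) ?_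
    exact integral_nonpos fun y => mul_nonpos_of_nonpos_of_nonneg (hΔ _) (weight_nonneg _ _)
  rw [← wmean_zero]
  exact hanti Set.self_mem_Ici hR hR

/-- After z = R y the left side is the integral of f against the weight at z / R, which tends to 1
boundedly; dominated convergence applies. -/
theorem tendsto_pow_mul_wmean {k : ℕ} {f : EuclideanSpace ℝ (Fin n) → ℝ}
    (hf : Integrable f) :
    Tendsto (fun R : ℝ => R ^ n * wmean k f 0 R) atTop (𝓝 (∫ x, f x)) := by
  have h1 : ∀ R : ℝ, 0 < R → R ^ n * wmean k f 0 R = ∫ z, f z * weight k (R⁻¹ • z) := by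
    intro R hR
    have h := Measure.integral_comp_smul_of_nonneg (volume : Measure (EuclideanSpace ℝ (Fin n)))
      (fun z => f z * weight k (R⁻¹ • z)) R (hR := hR.le)
    simp only [inv_smul_smul₀ hR.ne', finrank_euclideanSpace_fin, smul_eq_mul] at h
    simp only [wmean, zero_add]
    rw [h, mul_inv_cancel_left₀ (by positivity)]
  have h2 : Tendsto (fun R : ℝ => ∫ z, f z * weight k (R⁻¹ • z)) atTop (𝓝 (∫ x, f x)) := by
    refine tendsto_integral_filter_of_dominated_convergence (fun z => ‖f z‖) ?_ ?_ hf.norm ?_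
    · refine Eventually.of_forall fun R => hf.aestronglyMeasurable.mul ?_
      exact ((continuous_weight k).comp (by fun_prop)).aestronglyMeasurable
    · refine Eventually.of_forall fun R => ae_of_all _ fun z => ?_
      rw [norm_mul, Real.norm_of_nonneg (weight_nonneg _ _)]
      exact mul_le_of_le_one_right (norm_nonneg _) (weight_le_one _ _)
    · refine ae_of_all _ fun z => ?_
      have h3 : Tendsto (fun R : ℝ => R⁻¹ • z) atTop (𝓝 0) := by
        simpa using (tendsto_inv_atTop_zero (𝕜 := ℝ)).smul_const z
      have h4 := ((continuous_weight k).tendsto 0).comp h3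
      have h5 : weight k (0 : EuclideanSpace ℝ (Fin n)) = 1 := by simp [weight]
      simpa [h5] using h4.const_mul (f z)
  refine h2.congr' ?_
  filter_upwards [eventually_gt_atTop 0] with R hR using (h1 R hR).symm

/-- Polar coordinates: n |B| (1/n - 1/(n+2)). -/
theorem weightMass_eq (hn : 1 ≤ n) : weightMass n
    = volume.real (Metric.ball (0 : EuclideanSpace ℝ (Fin n)) 1) * (2 / (n + 2)) := by
  have : Nonempty (Fin n) := ⟨⟨0, hn⟩⟩
  have h := integral_fun_norm_addHaar (volume : Measure (EuclideanSpace ℝ (Fin n)))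
    (fun r => max 0 (1 - r ^ 2))
  have h1 : ∫ r in Set.Ioi (0 : ℝ), r ^ (n - 1) • max 0 (1 - r ^ 2)
      = ∫ r in (0 : ℝ)..1, (r ^ (n - 1) - r ^ (n + 1)) := by
    rw [intervalIntegral.integral_of_le zero_le_one, ← Set.Ioc_union_Ioi_eq_Ioi zero_le_one,
      setIntegral_eq_of_subset_of_forall_sdiff_eq_zero
        (s := Set.Ioc 0 1) (by measurability) Set.subset_union_left ?_]
    · refine setIntegral_congr_fun measurableSet_Ioc fun r hr => ?_
      have : r ^ 2 ≤ 1 := pow_le_one₀ hr.1.le hr.2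
      simp only [smul_eq_mul]
      rw [max_eq_right (by linarith), mul_sub, mul_one, ← pow_add]
      congr 2
      omega
    · intro r hr
      have hr1 : 1 < r := by
        rcases hr with ⟨h1 | h1, h2⟩
        · exact absurd h1 h2
        · exact h1
      rw [max_eq_left (by nlinarith), smul_zero]
  rw [finrank_euclideanSpace_fin, h1, intervalIntegral.integral_sub (by simp) (by simp),
    integral_pow, integral_pow] at h
  simp only [weightMass, weight, pow_one]
  rw [h]
  have hn' : (n : ℝ) ≠ 0 := by positivity
  have e : ((n - 1 : ℕ) : ℝ) = n - 1 := by push_cast [hn]; ring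
  simp only [nsmul_eq_mul, smul_eq_mul, e]
  push_cast
  have : (n : ℝ) + 1 + 1 ≠ 0 := by positivity
  simp
  field_simp
  ring

/-! ### One-variable asymptotics recovered from derivatives. -/

/-- As k ≥ 1, G is O(s⁻²), hence integrable at infinity, so F has a limit a. L'Hôpital's rule for F
- a against s⁻ᵏ gives the rate. -/
theorem exists_tendsto_pow_mul_sub {F G : ℝ → ℝ} {k : ℕ} (hk : 1 ≤ k) {L : ℝ}
    (hF : ∀ s, 0 < s → HasDerivAt F (G s) s)
    (hG : Tendsto (fun s => s ^ (k + 1) * G s) atTop (𝓝 L)) :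
    ∃ a, Tendsto (fun s => s ^ k * (F s - a)) atTop (𝓝 (-L / k)) := by
  have hlim : ∃ a, Tendsto F atTop (𝓝 a) := by
    have hb : ∀ᶠ s in atTop, ‖s ^ (k + 1) * G s‖ < ‖L‖ + 1 :=
      hG.norm.eventually_lt_const (by linarith)
    obtain ⟨s₀, hs₀⟩ := (hb.and (eventually_ge_atTop 1)).exists_forall_of_atTop
    have hs₀1 : 1 ≤ s₀ := (hs₀ s₀ le_rfl).2
    have hd : ∀ s ∈ Set.Ioi s₀, HasDerivAt F (G s) s := fun s hs =>
      hF s (by linarith [Set.mem_Ioi.1 hs])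
    refine ⟨_, tendsto_limUnder_of_hasDerivAt_of_integrableOn_Ioi hd ?_⟩
    have hint : IntegrableOn (fun s : ℝ => (‖L‖ + 1) * s ^ (-2 : ℝ)) (Set.Ioi s₀) :=
      (integrableOn_Ioi_rpow_of_lt (by norm_num) (by linarith)).const_mul _
    refine hint.mono' ?_ ?_
    · refine ((measurable_deriv F).aestronglyMeasurable).congr ?_
      filter_upwards [ae_restrict_mem measurableSet_Ioi] with s hs using (hd s hs).deriv
    · filter_upwards [ae_restrict_mem measurableSet_Ioi] with s hs
      have hs' := hs₀ s (le_of_lt hs)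
      have hs0 : 0 < s := by linarith [hs'.2]
      have h1 : s ^ 2 * ‖G s‖ ≤ ‖L‖ + 1 := by
        refine le_trans ?_ hs'.1.le
        rw [norm_mul, Real.norm_of_nonneg (by positivity : (0 : ℝ) ≤ s ^ (k + 1))]
        exact mul_le_mul_of_nonneg_right (pow_le_pow_right₀ hs'.2 (by omega)) (norm_nonneg _)
      rw [Real.rpow_neg hs0.le, ← div_eq_mul_inv, le_div_iff₀ (by positivity), mul_comm]
      exact_mod_cast h1
  obtain ⟨a, ha⟩ := hlim
  refine ⟨a, ?_⟩
  have hk0 : (k : ℝ) ≠ 0 := by positivity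
  have h := HasDerivAt.lhopital_zero_atTop (f := fun s => F s - a) (f' := G)
    (g := fun s : ℝ => (s ^ k)⁻¹) (g' := fun s => -(k * s ^ (k - 1)) / (s ^ k) ^ 2)
    (l := 𝓝 (-L / k)) ?_ ?_ ?_ ?_ ?_ ?_
  · refine h.congr' ?_
    filter_upwards [eventually_gt_atTop 0] with s hs
    field_simp
  · filter_upwards [eventually_gt_atTop 0] with s hs using (hF s hs).sub_const a
  · filter_upwards [eventually_gt_atTop 0] with s hs
    exact (hasDerivAt_pow k s).inv (by positivity)
  · filter_upwards [eventually_gt_atTop 0] with s hs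
    have : (0 : ℝ) < k := by positivity
    exact div_ne_zero (neg_ne_zero.2 (by positivity)) (by positivity)
  · simpa using ha.sub_const a
  · exact (tendsto_pow_atTop (by omega)).inv_tendsto_atTop
  · have h1 := (hG.neg).div_const (k : ℝ)
    refine h1.congr' ?_
    filter_upwards [eventually_gt_atTop 0] with s hs
    obtain ⟨j, rfl⟩ : ∃ j, k = j + 1 := ⟨k - 1, by omega⟩
    simp only [Nat.add_sub_cancel]
    field_simp
    ring

/-- The mean value inequality for H(t) - L t beyond t₀ leaves an error (ε/2)(t - t₀) plus a
constant, which division by t absorbs. -/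
theorem tendsto_div_of_tendsto_deriv {H H' : ℝ → ℝ} {L : ℝ}
    (hH : ∀ t, HasDerivAt H (H' t) t) (hL : Tendsto H' atTop (𝓝 L)) :
    Tendsto (fun t => H t / t) atTop (𝓝 L) := by
  rw [Metric.tendsto_atTop]
  intro ε hε
  obtain ⟨t₀, ht₀⟩ := Metric.tendsto_atTop.1 hL (ε / 2) (by positivity)
  have hbd : ∀ t, t₀ ≤ t → |H t - H t₀ - L * (t - t₀)| ≤ ε / 2 * (t - t₀) := by
    intro t ht
    have h := Convex.norm_image_sub_le_of_norm_hasDerivWithin_le (s := Set.Ici t₀)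
      (f := fun t => H t - L * t) (f' := fun t => H' t - L) (C := ε / 2) (x := t₀) (y := t)
      (fun x _ => by
        simpa using ((hH x).fun_sub ((hasDerivAt_id x).const_mul L)).hasDerivWithinAt)
      (fun x hx => (ht₀ x hx).le) (convex_Ici t₀) Set.self_mem_Ici ht
    rw [Real.norm_eq_abs, Real.norm_eq_abs, abs_of_nonneg (sub_nonneg.2 ht)] at h
    convert h using 2
    ring
  set K := |H t₀ - L * t₀| + ε / 2 * |t₀| with hK
  refine ⟨max (max t₀ 1) (2 * K / ε + 1), fun t ht => ?_⟩
  have h1 : t₀ ≤ t := (le_max_left _ _).trans ((le_max_left _ _).trans ht)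
  have h2 : 1 ≤ t := (le_max_right _ _).trans ((le_max_left _ _).trans ht)
  have h3 : 2 * K / ε + 1 ≤ t := (le_max_right _ _).trans ht
  have h0 : 0 < t := by linarith
  have h4 : 2 * K < t * ε := by
    rw [← div_lt_iff₀ hε]
    linarith
  rw [Real.dist_eq, show H t / t - L = (H t - L * t) / t by field_simp, abs_div, abs_of_pos h0,
    div_lt_iff₀ h0]
  have h5 := abs_le.1 (hbd t h1)
  have h6 := neg_abs_le (H t₀ - L * t₀)
  have h7 := le_abs_self (H t₀ - L * t₀)
  have h8 : ε / 2 * -t₀ ≤ ε / 2 * |t₀| := by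
    have := neg_abs_le t₀
    gcongr
    linarith
  rw [abs_lt]
  constructor <;> nlinarith

theorem tendsto_div_log {F G : ℝ → ℝ} {L : ℝ} (hF : ∀ s, 0 < s → HasDerivAt F (G s) s)
    (hG : Tendsto (fun s => s * G s) atTop (𝓝 L)) :
    Tendsto (fun s => F s / Real.log s) atTop (𝓝 L) := by
  have h := tendsto_div_of_tendsto_deriv (H := fun t => F (Real.exp t))
    (H' := fun t => Real.exp t * G (Real.exp t)) (L := L) (fun t => by
      rw [mul_comm]
      exact (hF _ (Real.exp_pos t)).comp t (Real.hasDerivAt_exp t))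
    (hG.comp Real.tendsto_exp_atTop)
  refine (h.comp Real.tendsto_log_atTop).congr' ?_
  filter_upwards [eventually_gt_atTop 0] with s hs
  simp [Real.exp_log hs]

/-- If the `m`-th derivative of a function is asymptotic to `L s⁻ᵐ`, then the function is,
up to a polynomial, asymptotic to a multiple of the logarithm. -/
theorem exists_polynomial_tendsto_div_log {m : ℕ} (hm : 1 ≤ m) :
    ∀ {D : ℕ → ℝ → ℝ} {L : ℝ},
      (∀ k < m, ∀ s, 0 < s → HasDerivAt (D k) (D (k + 1) s) s) →
      Tendsto (fun s => s ^ m * D m s) atTop (𝓝 L) →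
      ∃ P : Polynomial ℝ, Tendsto (fun s => (D 0 s - P.eval s) / Real.log s) atTop
        (𝓝 ((-1) ^ (m - 1) * L / (m - 1)!)) := by
  induction m, hm using Nat.le_induction with
  | base =>
    intro D L hD hL
    refine ⟨0, ?_⟩
    simpa using tendsto_div_log (hD 0 one_pos) (by simpa using hL)
  | succ m hm ih =>
    intro D L hD hL
    obtain ⟨a, ha⟩ := exists_tendsto_pow_mul_sub hm (hD m (Nat.lt_succ_self m)) hL
    -- From each D k the k-th derivative of (a/m!) sᵐ is subtracted. At k = m this removes the limit
    -- a of D m, leaving a remainder of order s⁻ᵐ.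
    obtain ⟨P, hP⟩ := ih (D := fun k s => D k s - a / (m - k)! * s ^ (m - k)) (L := -L / m)
      (fun k hk s hs => by
        refine (hD k (by omega) s hs).sub ?_
        obtain ⟨j, hj⟩ : ∃ j, m - k = j + 1 := ⟨m - k - 1, by omega⟩
        rw [hj, show m - (k + 1) = j by omega]
        have e : a / (j + 1)! * (((j + 1 : ℕ) : ℝ) * s ^ j) = a / j ! * s ^ j := by
          rw [Nat.factorial_succ]
          have := Nat.factorial_ne_zero j
          push_cast
          field_simp
        rw [← e]
        exact (hasDerivAt_pow (j + 1) s).const_mul (a / ((j + 1)! : ℝ))) (by simpa using ha)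
    refine ⟨P + Polynomial.C (a / m !) * Polynomial.X ^ m, ?_⟩
    have e : (-1) ^ (m - 1) * (-L / m) / ((m - 1)! : ℝ)
        = (-1) ^ (m + 1 - 1) * L / ((m + 1 - 1)! : ℝ) := by
      obtain ⟨j, rfl⟩ : ∃ j, m = j + 1 := ⟨m - 1, by omega⟩
      simp only [Nat.add_sub_cancel, Nat.factorial_succ]
      have := Nat.factorial_ne_zero j
      push_cast
      field_simp
      ring
    rw [← e]
    refine hP.congr fun s => ?_
    simp
    ring

/-- Logarithmic growth of F forces P(s) = O(log s) = o(s), so P is constant and disappears after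
division by log s. -/
theorem tendsto_div_log_of_bounds {F : ℝ → ℝ} {P : Polynomial ℝ} {ℓ C : ℝ}
    (h : Tendsto (fun s => (F s - P.eval s) / Real.log s) atTop (𝓝 ℓ))
    (hF : ∀ᶠ s in atTop, |F s| ≤ C * Real.log s) :
    Tendsto (fun s => F s / Real.log s) atTop (𝓝 ℓ) := by
  have hlog1 : ∀ᶠ s : ℝ in atTop, 1 ≤ Real.log s :=
    Real.tendsto_log_atTop.eventually_ge_atTop 1
  have hP : ∀ᶠ s in atTop, |P.eval s / Real.log s| ≤ C + (|ℓ| + 1) := by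
    filter_upwards [hF, hlog1, h.abs.eventually_le_const (lt_add_one |ℓ|)] with s h1 h2 h3
    have h0 : 0 < Real.log s := by linarith
    have h4 : |F s / Real.log s| ≤ C := by
      rw [abs_div, abs_of_pos h0, div_le_iff₀ h0]
      exact h1
    have h5 : P.eval s / Real.log s = F s / Real.log s - (F s - P.eval s) / Real.log s := by ring
    rw [h5]
    exact (abs_sub _ _).trans (add_le_add h4 h3)
  have hlogs : Tendsto (fun s : ℝ => Real.log s / s) atTop (𝓝 0) := by
    simpa using Real.isLittleO_log_id_atTop.tendsto_div_nhds_zero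
  have hPX : Tendsto (fun s => P.eval s / Polynomial.eval s Polynomial.X) atTop (𝓝 0) := by
    have h1 : Tendsto (fun s => (C + (|ℓ| + 1)) * (Real.log s / s)) atTop (𝓝 0) := by
      simpa using hlogs.const_mul (C + (|ℓ| + 1))
    refine squeeze_zero_norm' ?_ h1
    filter_upwards [hP, hlog1, eventually_gt_atTop 0] with s h2 h3 h4
    have h0 : 0 < Real.log s := by linarith
    rw [Polynomial.eval_X, Real.norm_eq_abs,
      show P.eval s / s = P.eval s / Real.log s * (Real.log s / s) by field_simp, abs_mul,
      abs_of_pos (div_pos h0 h4)]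
    gcongr
  have hdeg :=
    (Polynomial.div_tendsto_atTop_zero_iff_degree_lt P Polynomial.X Polynomial.X_ne_zero).1 hPX
  rw [Polynomial.degree_X] at hdeg
  have hc := Polynomial.eq_C_of_degree_le_zero (Nat.WithBot.lt_one_iff_le_zero.1 hdeg)
  have h2 : Tendsto (fun s => P.eval s / Real.log s) atTop (𝓝 0) := by
    rw [hc]
    simp only [Polynomial.eval_C]
    exact tendsto_const_nhds.div_atTop Real.tendsto_log_atTop
  have h3 := h.add h2
  rw [add_zero] at h3
  refine h3.congr fun s => ?_
  ring

/-! ### Normalising constants and the logarithmic asymptotics of the means of u. -/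

theorem eventually_cocompact_iff {P : EuclideanSpace ℝ (Fin n) → Prop} :
    (∀ᶠ x in cocompact (EuclideanSpace ℝ (Fin n)), P x) ↔ ∃ R, 1 ≤ R ∧ ∀ x, R ≤ ‖x‖ → P x := by
  rw [← Metric.cobounded_eq_cocompact, hasBasis_cobounded_norm.eventually_iff]
  constructor
  · rintro ⟨R, -, h⟩
    exact ⟨max 1 R, le_max_left _ _, fun x hx => h ((le_max_right _ _).trans hx)⟩
  · rintro ⟨R, -, h⟩
    exact ⟨R, trivial, fun x hx => h x hx⟩

theorem weightMass_two_mul {m : ℕ} (hm : 1 ≤ m) :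
    weightMass (2 * m) = Real.pi ^ m / (m + 1)! := by
  have : Nontrivial (EuclideanSpace ℝ (Fin (2 * m))) :=
    Module.nontrivial_of_finrank_pos (R := ℝ) (by simp; omega)
  rw [weightMass_eq (by omega), measureReal_def,
    InnerProductSpace.volume_ball_of_dim_even (k := m) (by simp)]
  have h1 : (0 : ℝ) ≤ Real.pi ^ m / (m : ℕ)! := by positivity
  rw [ENNReal.ofReal_one, one_pow, one_mul, ENNReal.toReal_ofReal h1, Nat.factorial_succ]
  have := Nat.factorial_ne_zero m
  push_cast
  field_simp

/-- With `weightMass_two_mul`, this closed form identifies the constant produced by m integrations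
with the geometric one in `alphaQ`. -/
theorem factorial_mul_sphereVolume {m : ℕ} (hm : 1 ≤ m) :
    ((2 * m - 1)! : ℝ) * sphereVolume (2 * m) = 4 ^ m * (m - 1)! * Real.pi ^ m := by
  obtain ⟨k, rfl⟩ : ∃ k, m = k + 1 := ⟨m - 1, by omega⟩
  rw [sphereVolume, Measure.toSphere_real_apply_univ, measureReal_def,
    InnerProductSpace.volume_ball_of_dim_odd (k := k + 1) (by simp)]
  simp only [finrank_euclideanSpace_fin]
  rw [ENNReal.ofReal_one, one_pow, one_mul, ENNReal.toReal_ofReal (by positivity)]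
  have h1 : (2 * (k + 1) + 1)‼ = (2 * (k + 1) + 1) * (2 * k + 1)‼ := rfl
  have h2 : (2 * (k + 1) - 1)! = (2 * k + 1)‼ * (2 ^ k * k !) := by
    rw [← Nat.doubleFactorial_two_mul, ← Nat.factorial_eq_mul_doubleFactorial]
    rfl
  have h3 : ((2 * k + 1)‼ : ℝ) ≠ 0 := by
    exact_mod_cast (Nat.doubleFactorial_pos _).ne'
  rw [h1, h2, show (4 : ℝ) = 2 * 2 by norm_num, mul_pow]
  simp only [Nat.add_sub_cancel]
  push_cast
  have h4 : (2 * ((k : ℝ) + 1) + 1) ≠ 0 := by positivity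
  field_simp
  ring

theorem contDiff_negLaplacianPow {u : EuclideanSpace ℝ (Fin n) → ℝ} (hu : ContDiff ℝ ∞ u)
    (k : ℕ) : ContDiff ℝ ∞ (negLaplacianPow k u) := by
  induction k with
  | zero => exact hu
  | succ k ih =>
    rw [negLaplacianPow, Function.iterate_succ_apply']
    exact (contDiff_laplacian ih).neg

theorem wmean_negLaplacianPow_succ (k : ℕ) (u : EuclideanSpace ℝ (Fin n) → ℝ) (j : ℕ) (R : ℝ) :
    wmean j (negLaplacianPow (k + 1) u) 0 R = -wmean j (Δ (negLaplacianPow k u)) 0 R := by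
  rw [show negLaplacianPow (k + 1) u = fun x => -(Δ (negLaplacianPow k u) x) from
    Function.iterate_succ_apply' _ _ _]
  simp only [wmean, neg_mul, integral_neg]

/-- In the variable s = R² the factor R of `hasDerivAt_wmean` cancels, leaving a constant
coefficient. -/
theorem hasDerivAt_wmean_sqrt {k : ℕ} (hk : 1 ≤ k) {f : EuclideanSpace ℝ (Fin n) → ℝ}
    (hf : ContDiff ℝ ∞ f) {s : ℝ} (hs : 0 < s) :
    HasDerivAt (fun s => wmean k f 0 (√s)) (1 / (4 * (k + 1)) * wmean (k + 1) (Δ f) 0 (√s)) s := by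
  have h := (hasDerivAt_wmean hk hf 0 (√s)).comp s (Real.hasDerivAt_sqrt hs.ne')
  refine h.congr_deriv ?_
  have := Real.sqrt_pos.2 hs
  field_simp
  ring

/-- The constant `2 ∫ Q eⁿᵘ / ((n-1)! |𝕊ⁿ|)`. -/
noncomputable def alphaQ (u : EuclideanSpace ℝ (Fin n) → ℝ) : ℝ :=
  2 / (((n - 1)! : ℝ) * sphereVolume n) * ∫ x, qDensity u x

theorem qDensity_eq (u : EuclideanSpace ℝ (Fin n) → ℝ) :
    qDensity u = negLaplacianPow (n / 2) u := by
  funext x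
  rw [qDensity, qCurvature, mul_assoc, ← Real.exp_add]
  simp

/-- The means of `u` grow like `-α log R` as soon as they grow at most logarithmically. -/
theorem tendsto_wmean_div_log {u : EuclideanSpace ℝ (Fin n) → ℝ} (hn : 4 ≤ n) (hn_even : Even n)
    (hu : ContDiff ℝ ∞ u) (hQ : Integrable (qDensity u)) {C : ℝ}
    (hC : ∀ᶠ R in atTop, |wmean 1 u 0 R| ≤ C * Real.log R) :
    Tendsto (fun R => wmean 1 u 0 R / Real.log R) atTop (𝓝 (-alphaQ u * weightMass n)) := by
  obtain ⟨m, rfl⟩ : ∃ m, n = 2 * m := hn_even.exists_two_nsmul _ |>.imp fun m h => by simpa using h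
  have hm : 1 ≤ m := by omega
  -- D k is the k-th derivative in s of the mean of u over radius √s. The factors 4·2, 4·3, …,
  -- 4(k+1) multiply to 4ᵏ (k+1)!, and the sign converts Δ into -Δ.
  set D : ℕ → ℝ → ℝ := fun k s =>
    (-1) ^ k / (4 ^ k * (k + 1)!) * wmean (k + 1) (negLaplacianPow k u) 0 (√s) with hDdef
  have hD : ∀ k < m, ∀ s, 0 < s → HasDerivAt (D k) (D (k + 1) s) s := by
    intro k _ s hs
    have h := (hasDerivAt_wmean_sqrt (k := k + 1) (by omega) (contDiff_negLaplacianPow hu k)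
      hs).const_mul ((-1) ^ k / (4 ^ k * ((k + 1)! : ℝ)))
    refine HasDerivAt.congr_deriv (f := D k) h ?_
    simp only [hDdef, wmean_negLaplacianPow_succ]
    rw [Nat.factorial_succ (k + 1)]
    have := Nat.factorial_ne_zero (k + 1)
    push_cast
    field_simp
    ring
  have hint : Integrable (negLaplacianPow m u) := by
    rw [qDensity_eq] at hQ
    simpa using hQ
  have hL : Tendsto (fun s => s ^ m * D m s) atTop
      (𝓝 ((-1) ^ m / (4 ^ m * (m + 1)!) * ∫ x, qDensity u x)) := by
    have h := (((tendsto_pow_mul_wmean (k := m + 1) hint).comp Real.tendsto_sqrt_atTop)).const_mul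
      ((-1) ^ m / (4 ^ m * ((m + 1)! : ℝ)))
    rw [qDensity_eq, show 2 * m / 2 = m by omega]
    refine h.congr' ?_
    filter_upwards [eventually_ge_atTop 0] with s hs
    simp only [hDdef, Function.comp]
    rw [pow_mul, Real.sq_sqrt hs]
    ring
  obtain ⟨P, hP⟩ := exists_polynomial_tendsto_div_log hm hD hL
  have hlogsqrt : ∀ s : ℝ, 0 ≤ s → Real.log s = 2 * Real.log (√s) := fun s hs => by
    rw [Real.log_sqrt hs]
    ring
  have hD0 : D 0 = fun s => wmean 1 u 0 (√s) := by
    funext s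
    simp [hDdef, negLaplacianPow]
  have hbd : ∀ᶠ s in atTop, |D 0 s| ≤ (C / 2) * Real.log s := by
    filter_upwards [Real.tendsto_sqrt_atTop.eventually hC, eventually_ge_atTop 0] with s h1 h2
    rw [hD0, hlogsqrt s h2]
    linarith
  -- Return to the radius through s = R²; log s = 2 log R accounts for the factor 2 below.
  have h := (tendsto_div_log_of_bounds hP hbd).comp (tendsto_pow_atTop (two_ne_zero))
  have h2 := h.const_mul 2
  have e : 2 * ((-1) ^ (m - 1) * ((-1) ^ m / (4 ^ m * (m + 1)!) * ∫ x, qDensity u x) / (m - 1)!)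
      = -alphaQ u * weightMass (2 * m) := by
    rw [alphaQ, factorial_mul_sphereVolume hm, weightMass_two_mul hm]
    obtain ⟨k, rfl⟩ : ∃ k, m = k + 1 := ⟨m - 1, by omega⟩
    simp only [Nat.add_sub_cancel]
    have h3 : (-1 : ℝ) ^ (k * 2) = 1 := by simp [pow_mul']
    have := Nat.factorial_ne_zero k
    have := Nat.factorial_ne_zero (k + 1 + 1)
    field_simp
    ring_nf
    rw [h3]
    ring
  rw [e] at h2
  refine h2.congr' ?_
  filter_upwards [eventually_gt_atTop 1] with R hR
  have := Real.log_pos hR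
  simp only [Function.comp, hD0]
  rw [Real.sqrt_sq (by linarith), Real.log_pow]
  push_cast
  field_simp

/-! ### Superharmonicity near infinity and the minimum principle. -/

/-- A bounded positive function on `ℝⁿ` that is strictly superharmonic when `4 ≤ n`. -/
noncomputable def bump (x : EuclideanSpace ℝ (Fin n)) : ℝ := (1 + ‖x‖ ^ 2)⁻¹

theorem contDiff_bump : ContDiff ℝ ∞ (bump : EuclideanSpace ℝ (Fin n) → ℝ) :=
  (contDiff_const.add (contDiff_norm_sq ℝ)).inv fun x => by positivity

theorem bump_nonneg (x : EuclideanSpace ℝ (Fin n)) : 0 ≤ bump x := by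
  unfold bump; positivity

theorem bump_le_one (x : EuclideanSpace ℝ (Fin n)) : bump x ≤ 1 :=
  inv_le_one_of_one_le₀ (by nlinarith [norm_nonneg x])

/-- The Laplacian equals -2(n + (n-4)‖x‖²)/(1 + ‖x‖²)³, so the sign for all x rests on n ≥ 4. -/
theorem laplacian_bump_neg (hn : 4 ≤ n) (x : EuclideanSpace ℝ (Fin n)) : Δ bump x < 0 := by
  have hd : ∀ s : ℝ, 1 + s ≠ 0 → HasDerivAt (fun s : ℝ => (1 + s)⁻¹) (-((1 + s) ^ 2)⁻¹) s :=
    fun s hs => by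
      simpa [neg_div] using ((hasDerivAt_id s).const_add 1).fun_inv hs
  have hd2 : ∀ s : ℝ, 1 + s ≠ 0 →
      HasDerivAt (fun s : ℝ => -((1 + s) ^ 2)⁻¹) (2 * ((1 + s) ^ 3)⁻¹) s := fun s hs => by
    convert! ((((hasDerivAt_id s).const_add 1).pow 2).inv (pow_ne_zero 2 hs)).neg using 1
    simp
    field_simp
  have h0 : (1 : ℝ) + ‖x‖ ^ 2 ≠ 0 := by positivity
  have h := laplacian_radial (n := n) (x := x) (g := fun s => (1 + s)⁻¹)
    (g₁ := fun s => -((1 + s) ^ 2)⁻¹)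
    ((contDiffAt_const.add contDiffAt_id).inv h0)
    (by
      filter_upwards [lt_mem_nhds (show (-1 : ℝ) < ‖x‖ ^ 2 by nlinarith [norm_nonneg x])] with s hs
      exact hd s (by linarith)) (hd2 _ h0)
  rw [show Δ bump x = _ from h]
  have hn' : (4 : ℝ) ≤ n := by exact_mod_cast hn
  have e : 4 * ‖x‖ ^ 2 * (2 * ((1 + ‖x‖ ^ 2) ^ 3)⁻¹) + 2 * n * -((1 + ‖x‖ ^ 2) ^ 2)⁻¹
      = -(2 * (n + (n - 4) * ‖x‖ ^ 2)) / (1 + ‖x‖ ^ 2) ^ 3 := by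
    field_simp
    ring
  rw [e]
  refine div_neg_of_neg_of_pos ?_ (by positivity)
  nlinarith [mul_nonneg (sub_nonneg.2 hn') (sq_nonneg ‖x‖)]

/-- On the compact ball where Δf may be positive, Δf / Δ`bump` is bounded, so a large multiple of
`bump` compensates. As `bump` takes values in [0, 1], this changes f by a bounded amount only. -/
theorem exists_add_bump_superharmonic (hn : 4 ≤ n) {f : EuclideanSpace ℝ (Fin n) → ℝ}
    (hf : ContDiff ℝ ∞ f)
    (hΔ : ∀ᶠ x in cocompact (EuclideanSpace ℝ (Fin n)), Δ f x ≤ 0) :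
    ∃ A : ℝ, 0 ≤ A ∧ ∀ x, Δ (fun y => f y + A * bump y) x ≤ 0 := by
  obtain ⟨R, -, hR⟩ := eventually_cocompact_iff.1 hΔ
  have hb : ContDiff ℝ ∞ (bump : EuclideanSpace ℝ (Fin n) → ℝ) := contDiff_bump
  have hc : Continuous fun x => Δ f x / Δ (bump : EuclideanSpace ℝ (Fin n) → ℝ) x :=
    (contDiff_laplacian hf).continuous.div₀ (contDiff_laplacian hb).continuous
      fun x => (laplacian_bump_neg hn x).ne
  obtain ⟨A, hA⟩ := (isCompact_closedBall (0 : EuclideanSpace ℝ (Fin n))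
    R).exists_bound_of_continuousOn hc.continuousOn
  refine ⟨max 0 A, le_max_left _ _, fun x => ?_⟩
  have hneg := laplacian_bump_neg hn x
  change Δ (f + max 0 A • (bump : EuclideanSpace ℝ (Fin n) → ℝ)) x ≤ 0
  have hAb : ContDiffAt ℝ 2 (max 0 A • (bump : EuclideanSpace ℝ (Fin n) → ℝ)) x :=
    (contDiff_two hb).contDiffAt.const_smul (max 0 A)
  rw [(contDiff_two hf).contDiffAt.laplacian_add hAb,
    InnerProductSpace.laplacian_smul _ (contDiff_two hb).contDiffAt, smul_eq_mul]
  rcases le_total R ‖x‖ with hx | hx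
  · have := mul_nonpos_of_nonneg_of_nonpos (le_max_left 0 A) hneg.le
    linarith [hR x hx]
  · have h1 := hA x (mem_closedBall_zero_iff.2 hx)
    have h2 : -max 0 A ≤ Δ f x / Δ bump x :=
      (neg_le_neg (h1.trans (le_max_right 0 A))).trans (neg_abs_le _)
    rw [le_div_iff_of_neg hneg] at h2
    linarith

/-- Mean value inequality, up to a constant, for functions superharmonic near infinity. -/
theorem exists_wmean_le (hn : 4 ≤ n) {f : EuclideanSpace ℝ (Fin n) → ℝ}
    (hf : ContDiff ℝ ∞ f)
    (hΔ : ∀ᶠ x in cocompact (EuclideanSpace ℝ (Fin n)), Δ f x ≤ 0) :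
    ∃ A : ℝ, ∀ x R, 0 ≤ R → wmean 1 f x R ≤ (f x + A) * weightMass n := by
  obtain ⟨A, hA, h⟩ := exists_add_bump_superharmonic hn hf hΔ
  have hg : ContDiff ℝ ∞ (fun y => f y + A * bump y) :=
    hf.add (contDiff_const.mul contDiff_bump)
  have hm : 0 ≤ weightMass n := integral_nonneg fun y => weight_nonneg 1 y
  refine ⟨A, fun x R hR => ?_⟩
  calc wmean 1 f x R ≤ wmean 1 (fun y => f y + A * bump y) x R := by
        refine integral_mono (integrable_wmean le_rfl hf.continuous x R)
          (integrable_wmean le_rfl hg.continuous x R) fun y => ?_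
        refine mul_le_mul_of_nonneg_right ?_ (weight_nonneg 1 y)
        simpa using mul_nonneg hA (bump_nonneg (x + R • y))
    _ ≤ (f x + A * bump x) * weightMass n := wmean_le_of_laplacian_nonpos hg h x hR
    _ ≤ (f x + A) * weightMass n := by
        refine mul_le_mul_of_nonneg_right ?_ hm
        simpa using mul_le_of_le_one_right hA (bump_le_one x)

/-- Minimum principle on the exterior of a ball. -/
theorem nonneg_of_superharmonic_exterior {ψ : EuclideanSpace ℝ (Fin n) → ℝ} {R : ℝ}
    (hψ : ∀ x, R ≤ ‖x‖ → ContDiffAt ℝ 2 ψ x) (hΔ : ∀ x, R ≤ ‖x‖ → Δ ψ x < 0)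
    (hbd : ∀ x, ‖x‖ = R → 0 ≤ ψ x)
    (hinf : ∀ ε > 0, ∀ᶠ x in cocompact (EuclideanSpace ℝ (Fin n)), -ε < ψ x)
    (x : EuclideanSpace ℝ (Fin n)) (hx : R ≤ ‖x‖) : 0 ≤ ψ x := by
  by_contra! hneg
  obtain ⟨R₁, -, hR₁⟩ := eventually_cocompact_iff.1 (hinf (-ψ x) (by linarith))
  -- Beyond this shell ψ exceeds ψ x, so a minimum over the shell is a minimum over the whole
  -- exterior. It is off the sphere of radius R, where ψ ≥ 0, which contradicts Δψ < 0.
  set K := {y : EuclideanSpace ℝ (Fin n) | R ≤ ‖y‖} ∩ Metric.closedBall 0 (max R₁ ‖x‖)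
  have hK : IsCompact K :=
    (isCompact_closedBall _ _).inter_left (isClosed_le continuous_const continuous_norm)
  obtain ⟨y, hyK, hy⟩ := hK.exists_isMinOn ⟨x, hx, by simp⟩
    fun z hz => (hψ z hz.1).continuousAt.continuousWithinAt
  have hyx : ψ y ≤ ψ x := hy ⟨hx, by simp⟩
  have hyR : R < ‖y‖ := lt_of_le_of_ne hyK.1 fun h => by
    linarith [hbd y h.symm]
  have hloc : IsLocalMin ψ y := by
    filter_upwards [continuous_norm.continuousAt.eventually (lt_mem_nhds hyR)] with z hz
    by_cases hz1 : ‖z‖ ≤ max R₁ ‖x‖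
    · exact hy ⟨hz.le, by simpa using hz1⟩
    · have := hR₁ z ((le_max_left _ _).trans (not_le.1 hz1).le)
      linarith
  exact (hΔ y hyR.le).not_ge (laplacian_nonneg_of_isLocalMin (hψ y hyR.le) hloc)

/-! ### From scalar curvature to a pointwise lower bound for u. -/

/-- The form in which curvature enters the analysis: c = 0 for nonnegative curvature, c = C‖x‖⁻ᵖ for
slow decay. -/
theorem laplacian_add_grad_sq_le_of_le_scalarCurvature (hn : 4 ≤ n)
    {u : EuclideanSpace ℝ (Fin n) → ℝ} (hu : ContDiff ℝ ∞ u) {x : EuclideanSpace ℝ (Fin n)} {c : ℝ}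
    (h : c ≤ scalarCurvature (conformalMetric u) x) :
    Δ u x + (n - 2) / 2 * ∑ k, partialDeriv k u x ^ 2
      ≤ -(c * Real.exp (2 * u x) / (2 * (n - 1))) := by
  have hn' : (4 : ℝ) ≤ n := by exact_mod_cast hn
  rw [scalarCurvature_conformalMetric hu, Real.exp_neg] at h
  have h1 : (0 : ℝ) < n - 1 := by linarith
  have h2 := Real.exp_pos (2 * u x)
  have h3 := mul_le_mul_of_nonneg_right h h2.le
  have h4 : (↑n - 1) * (Real.exp (2 * u x))⁻¹
        * (-(2 * Δ u x) - (n - 2) * ∑ k, partialDeriv k u x ^ 2) * Real.exp (2 * u x)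
      = (n - 1) * (-(2 * Δ u x) - (n - 2) * ∑ k, partialDeriv k u x ^ 2) := by
    field_simp
  rw [h4] at h3
  rw [le_neg, div_le_iff₀ (by positivity)]
  linarith

theorem grad_sq_nonneg (hn : 4 ≤ n) (u : EuclideanSpace ℝ (Fin n) → ℝ)
    (x : EuclideanSpace ℝ (Fin n)) :
    0 ≤ ((n : ℝ) - 2) / 2 * ∑ k, partialDeriv k u x ^ 2 := by
  have hn' : (4 : ℝ) ≤ n := by exact_mod_cast hn
  exact mul_nonneg (by linarith) (Finset.sum_nonneg fun k _ => sq_nonneg _)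

theorem hasDerivAt_zpow_add_zpow (m : ℤ) (a b : ℝ) {s : ℝ} (hs : s ≠ 0) :
    HasDerivAt (fun s : ℝ => a * s ^ (1 - m) + b * s ^ (-m))
      (a * (1 - m) * s ^ (-m) + b * (-m) * s ^ (-m - 1)) s := by
  have h1 := (hasDerivAt_zpow (1 - m) s (Or.inl hs)).const_mul a
  have h2 := (hasDerivAt_zpow (-m) s (Or.inl hs)).const_mul b
  refine (h1.add h2).congr_deriv ?_
  rw [show (1 - m - 1 : ℤ) = -m by ring]
  push_cast
  ring

/-- A barrier comparable to the fundamental solution `‖x‖^{2-2m}`, strictly subharmonic. -/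
theorem laplacian_barrier_pos {m : ℕ} (hm : 1 ≤ m) (hnm : n = 2 * m)
    {x : EuclideanSpace ℝ (Fin n)} (hx : x ≠ 0) :
    ContDiffAt ℝ 2 (fun y : EuclideanSpace ℝ (Fin n) =>
        (‖y‖ ^ 2) ^ (1 - m : ℤ) + (‖y‖ ^ 2) ^ (-m : ℤ)) x ∧
      0 < Δ (fun y : EuclideanSpace ℝ (Fin n) =>
        (‖y‖ ^ 2) ^ (1 - m : ℤ) + (‖y‖ ^ 2) ^ (-m : ℤ)) x := by
  have hs : 0 < ‖x‖ ^ 2 := by positivity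
  set g : ℝ → ℝ := fun s => s ^ (1 - m : ℤ) + s ^ (-m : ℤ) with hg
  have hgc : ContDiffAt ℝ 2 g (‖x‖ ^ 2) :=
    ((analyticAt_id.zpow hs.ne').add (analyticAt_id.zpow hs.ne')).contDiffAt
  refine ⟨hgc.comp x (contDiff_norm_sq ℝ).contDiffAt, ?_⟩
  have h := laplacian_radial (n := n) (x := x) (g := g)
    (g₁ := fun s => (1 - m) * s ^ (-m : ℤ) + (-m) * s ^ (-m - 1 : ℤ))
    (g₂ := (1 - m) * (-m) * (‖x‖ ^ 2) ^ (-m - 1 : ℤ)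
      + (-m) * (-m - 1) * (‖x‖ ^ 2) ^ (-m - 2 : ℤ)) hgc ?_ ?_
  · rw [h]
    have e1 : (‖x‖ ^ 2) ^ (-m : ℤ) = (‖x‖ ^ 2) ^ (-m - 1 : ℤ) * ‖x‖ ^ 2 := by
      rw [← zpow_add_one₀ hs.ne']
      congr 1
      ring
    have e2 : (‖x‖ ^ 2) ^ (-m - 1 : ℤ) = (‖x‖ ^ 2) ^ (-m - 2 : ℤ) * ‖x‖ ^ 2 := by
      rw [← zpow_add_one₀ hs.ne']
      congr 1
      ring
    have hpos : 0 < (‖x‖ ^ 2) ^ (-m - 2 : ℤ) := zpow_pos hs _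
    have hm' : (0 : ℝ) < m := by positivity
    have hnm' : (n : ℝ) = 2 * m := by exact_mod_cast hnm
    rw [e1, e2, hnm']
    set z := (‖x‖ ^ 2) ^ (-m - 2 : ℤ)
    have : 0 < 4 * m * (z * ‖x‖ ^ 2) := by positivity
    linarith
  · filter_upwards [lt_mem_nhds hs] with s hs0
    have := hasDerivAt_zpow_add_zpow m 1 1 hs0.ne'
    simpa [hg] using this
  · have h1 := hasDerivAt_zpow_add_zpow (m + 1) (1 - m) (-m) hs.ne'
    have e3 : (1 - (m + 1) : ℤ) = -m := by ring
    have e4 : (-(m + 1) : ℤ) = -m - 1 := by ring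
    have e5 : (-m - 1 - 1 : ℤ) = -m - 2 := by ring
    rw [e4, e5] at h1
    simp only [e3] at h1
    refine h1.congr_deriv ?_
    push_cast
    ring

/-- Nonnegative scalar curvature near infinity forces `u ≥ -2 log ‖x‖ - C`. -/
theorem exists_neg_two_log_le (hn : 4 ≤ n) (hn_even : Even n)
    {u : EuclideanSpace ℝ (Fin n) → ℝ} (hu : ContDiff ℝ ∞ u)
    (hR : ∀ᶠ x in cocompact (EuclideanSpace ℝ (Fin n)),
      0 ≤ scalarCurvature (conformalMetric u) x) :
    ∃ C, ∀ᶠ x in cocompact (EuclideanSpace ℝ (Fin n)), -2 * Real.log ‖x‖ - C ≤ u x := by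
  obtain ⟨m, hnm⟩ : ∃ m, n = 2 * m := hn_even.exists_two_nsmul _ |>.imp fun m h => by simpa using h
  have hm : 2 ≤ m := by omega
  have hm' : (0 : ℝ) < m - 1 := by
    have : (2 : ℝ) ≤ m := by exact_mod_cast hm
    linarith
  have hnm' : (n : ℝ) = 2 * m := by exact_mod_cast hnm
  obtain ⟨R, hR1, hR⟩ := eventually_cocompact_iff.1 hR
  -- The Yamabe substitution g = v^{4/(n-2)} |dx|²: with exponent m - 1 = (n-2)/2, Δv is a positive
  -- multiple of Δu + (n-2)/2 |∇u|².
  set v : EuclideanSpace ℝ (Fin n) → ℝ := fun x => Real.exp ((m - 1) * u x) with hv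
  have hvc : ContDiff ℝ ∞ v := (contDiff_const.mul hu).exp
  have hvΔ : ∀ x, R ≤ ‖x‖ → Δ v x ≤ 0 := by
    intro x hx
    have hd : ∀ c s : ℝ, HasDerivAt (fun s : ℝ => c * Real.exp ((m - 1) * s))
        (c * (m - 1) * Real.exp ((m - 1) * s)) s := fun c s => by
      have := (((hasDerivAt_id s).const_mul ((m : ℝ) - 1)).exp).const_mul c
      refine this.congr_deriv ?_
      simp
      ring
    rw [hv, laplacian_comp (g := fun s => Real.exp ((m - 1) * s))
      (g₁ := fun s => (m - 1) * Real.exp ((m - 1) * s)) (contDiff_two hu)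
      (by fun_prop) (Eventually.of_forall fun s => by simpa using hd 1 s) (hd (m - 1) (u x))]
    have h1 := laplacian_add_grad_sq_le_of_le_scalarCurvature hn hu (hR x hx)
    rw [hnm'] at h1
    have h2 : 0 < (m - 1) * Real.exp ((m - 1) * u x) := by positivity
    have h3 : Δ u x + (m - 1) * ∑ k, partialDeriv k u x ^ 2 ≤ 0 := by
      simp only [zero_mul, zero_div, neg_zero] at h1
      linarith
    nlinarith [mul_nonpos_of_nonneg_of_nonpos h2.le h3]
  obtain ⟨δ, hδ, hδv⟩ : ∃ δ, 0 < δ ∧ ∀ x, ‖x‖ ≤ R → δ ≤ v x := by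
    obtain ⟨y, -, hy⟩ := (isCompact_closedBall (0 : EuclideanSpace ℝ (Fin n)) R).exists_isMinOn
      ⟨0, by simp; linarith⟩ hvc.continuous.continuousOn
    exact ⟨v y, Real.exp_pos _, fun x hx => hy (mem_closedBall_zero_iff.2 hx)⟩
  set q : EuclideanSpace ℝ (Fin n) → ℝ :=
    fun y => (‖y‖ ^ 2) ^ (1 - m : ℤ) + (‖y‖ ^ 2) ^ (-m : ℤ) with hq
  have hne : ∀ x : EuclideanSpace ℝ (Fin n), R ≤ ‖x‖ → x ≠ 0 := fun x hx h => by
    rw [h, norm_zero] at hx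
    linarith
  -- As R ≥ 1, q ≤ 2 on the sphere of radius R, so (δ/2) q ≤ δ ≤ v there; at infinity q → 0 while v
  -- > 0. The logarithm of v ≥ (δ/2)‖x‖^{2-2m}, divided by m - 1, gives the coefficient -2.
  have hmain := nonneg_of_superharmonic_exterior (ψ := v - (δ / 2) • q) (R := R) ?_ ?_ ?_ ?_
  · refine ⟨-(Real.log (δ / 2) / (m - 1)), eventually_cocompact_iff.2 ⟨R, hR1, fun x hx => ?_⟩⟩
    have hx0 : 0 < ‖x‖ := by linarith
    have h1 := hmain x hx
    have h2 : δ / 2 * (‖x‖ ^ 2) ^ (1 - m : ℤ) ≤ v x := by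
      have h3 : 0 < (‖x‖ ^ 2) ^ (-m : ℤ) := by positivity
      have h4 : 0 ≤ v x - δ / 2 * ((‖x‖ ^ 2) ^ (1 - m : ℤ) + (‖x‖ ^ 2) ^ (-m : ℤ)) := h1
      nlinarith [mul_pos (half_pos hδ) h3]
    have h5 := Real.log_le_log (by positivity) h2
    rw [hv, Real.log_exp, Real.log_mul (by positivity) (by positivity), Real.log_zpow,
      Real.log_pow] at h5
    push_cast at h5
    have h6 : Real.log (δ / 2) / (m - 1) ≤ u x + 2 * Real.log ‖x‖ := by
      rw [div_le_iff₀ hm']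
      linarith
    linarith
  · intro x hx
    exact (contDiff_two hvc).contDiffAt.sub
      ((laplacian_barrier_pos (by omega) hnm (hne x hx)).1.const_smul (δ / 2))
  · intro x hx
    have hb := laplacian_barrier_pos (by omega) hnm (hne x hx)
    have hqs : ContDiffAt ℝ 2 ((δ / 2) • q) x := hb.1.const_smul (δ / 2)
    rw [(contDiff_two hvc).contDiffAt.laplacian_sub hqs,
      InnerProductSpace.laplacian_smul _ hb.1, smul_eq_mul]
    have := mul_pos (half_pos hδ) hb.2
    linarith [hvΔ x hx]
  · intro x hx
    have h1 : 1 ≤ ‖x‖ ^ 2 := one_le_pow₀ (by linarith)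
    have h2 : (‖x‖ ^ 2) ^ (1 - m : ℤ) ≤ 1 := zpow_le_one_of_nonpos₀ h1 (by omega)
    have h3 : (‖x‖ ^ 2) ^ (-m : ℤ) ≤ 1 := zpow_le_one_of_nonpos₀ h1 (by omega)
    have h4 := hδv x hx.le
    change 0 ≤ v x - δ / 2 * ((‖x‖ ^ 2) ^ (1 - m : ℤ) + (‖x‖ ^ 2) ^ (-m : ℤ))
    nlinarith
  · intro ε hε
    have hnorm : Tendsto (fun x : EuclideanSpace ℝ (Fin n) => ‖x‖ ^ 2) (cocompact _) atTop :=
      (tendsto_pow_atTop two_ne_zero).comp (tendsto_norm_cocompact_atTop)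
    have h1 : Tendsto q (cocompact _) (𝓝 0) := by
      have := ((tendsto_zpow_atTop_zero (𝕜 := ℝ) (n := 1 - m) (by omega)).comp hnorm).add
        ((tendsto_zpow_atTop_zero (𝕜 := ℝ) (n := -m) (by omega)).comp hnorm)
      rwa [add_zero] at this
    have h2 : Tendsto (fun x => δ / 2 * q x) (cocompact _) (𝓝 0) := by
      simpa using h1.const_mul (δ / 2)
    filter_upwards [h2.eventually_lt_const hε] with x hx
    have : 0 < v x := Real.exp_pos _
    change -ε < v x - δ / 2 * q x
    linarith

/-! ### Growth of u against growth of its means. -/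

theorem weightMass_pos (hn : 1 ≤ n) : 0 < weightMass n := by
  rw [weightMass_eq hn]
  have : 0 < volume.real (Metric.ball (0 : EuclideanSpace ℝ (Fin n)) 1) :=
    ENNReal.toReal_pos (Metric.measure_ball_pos _ _ one_pos).ne' measure_ball_lt_top.ne
  positivity

/-- The second moment of the weight `(1 - ‖y‖²)₊`. -/
noncomputable def weightMoment (n : ℕ) : ℝ :=
  ∫ y : EuclideanSpace ℝ (Fin n), ‖y‖ ^ 2 * weight 1 y

theorem weightMoment_pos (hn : 1 ≤ n) : 0 < weightMoment n := by
  have hc : Continuous fun y : EuclideanSpace ℝ (Fin n) => ‖y‖ ^ 2 * weight 1 y :=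
    (continuous_norm.pow 2).mul (continuous_weight 1)
  set e : EuclideanSpace ℝ (Fin n) := EuclideanSpace.single ⟨0, hn⟩ (1 / 2) with he
  have hne : ‖e‖ = 1 / 2 := by
    rw [he, PiLp.norm_single]
    norm_num
  refine hc.integral_pos_of_hasCompactSupport_nonneg_nonzero
    (hasCompactSupport_weight le_rfl).mul_left
    (fun y => mul_nonneg (sq_nonneg _) (weight_nonneg 1 y)) (x := e) ?_
  simp only [weight, hne]
  norm_num

theorem le_wmean_of_le {f : EuclideanSpace ℝ (Fin n) → ℝ} (hf : Continuous f)
    {R c : ℝ} (hR : 0 ≤ R) (h : ∀ x, ‖x‖ ≤ R → c ≤ f x) :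
    c * weightMass n ≤ wmean 1 f 0 R := by
  rw [weightMass, ← integral_const_mul]
  refine integral_mono ((integrable_weight le_rfl).const_mul c)
    (integrable_wmean le_rfl hf 0 R) fun y => ?_
  rcases le_or_gt 1 ‖y‖ with hy | hy
  · simp [weight_eq_zero le_rfl hy]
  · refine mul_le_mul_of_nonneg_right (h _ ?_) (weight_nonneg 1 y)
    rw [zero_add, norm_smul, Real.norm_of_nonneg hR]
    exact mul_le_of_le_one_right hR hy.le

/-- Concavity of log gives log(1 + tR²) ≥ t log(1 + R²) ≥ 2t log R for t = ‖y‖² ≤ 1. Later uses need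
only that the coefficient of log R is positive. -/
theorem weightMoment_mul_log_le_wmean {R : ℝ} (hR : 1 ≤ R) :
    weightMoment n * (2 * Real.log R)
      ≤ wmean 1 (fun x : EuclideanSpace ℝ (Fin n) => Real.log (1 + ‖x‖ ^ 2)) 0 R := by
  have hc : Continuous fun x : EuclideanSpace ℝ (Fin n) => Real.log (1 + ‖x‖ ^ 2) :=
    Continuous.log (by fun_prop) fun x => by positivity
  rw [weightMoment, ← integral_mul_const]
  refine integral_mono (Integrable.mul_const (integrable_mul_weight (le_refl 1)
    (f := fun y => ‖y‖ ^ 2) (by fun_prop)) _) (integrable_wmean le_rfl hc 0 R) fun y => ?_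
  rcases le_or_gt 1 ‖y‖ with hy | hy
  · simp [weight_eq_zero le_rfl hy]
  · have key : ‖y‖ ^ 2 * (2 * Real.log R)
        ≤ Real.log (1 + ‖(0 : EuclideanSpace ℝ (Fin n)) + R • y‖ ^ 2) := by
      have ht : ‖y‖ ^ 2 ≤ 1 := pow_le_one₀ (norm_nonneg y) hy.le
      have h1 : (2 : ℝ) * Real.log R ≤ Real.log (1 + R ^ 2) := by
        have h2 := Real.log_pow R 2
        push_cast at h2
        rw [← h2]
        exact Real.log_le_log (by positivity) (by linarith)
      have h3 := strictConcaveOn_log_Ioi.concaveOn.2 (show (1 : ℝ) ∈ Set.Ioi 0 by simp)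
        (show 1 + R ^ 2 ∈ Set.Ioi (0 : ℝ) by simp; positivity)
        (sub_nonneg.2 ht) (sq_nonneg ‖y‖) (by ring)
      simp only [smul_eq_mul, Real.log_one, mul_zero, zero_add] at h3
      rw [zero_add, norm_smul, Real.norm_of_nonneg (by linarith), mul_pow]
      rw [show 1 + R ^ 2 * ‖y‖ ^ 2 = (1 - ‖y‖ ^ 2) * 1 + ‖y‖ ^ 2 * (1 + R ^ 2) by ring]
      exact (mul_le_mul_of_nonneg_left h1 (sq_nonneg _)).trans h3
    have := mul_le_mul_of_nonneg_right key (weight_nonneg 1 y)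
    linarith

/-- A lower bound near infinity for a continuous function is, up to a constant, a global one. -/
theorem exists_forall_le_of_eventually_le {f g : EuclideanSpace ℝ (Fin n) → ℝ}
    (hf : Continuous f) (hg : Continuous g) {c : ℝ}
    (h : ∀ᶠ x in cocompact (EuclideanSpace ℝ (Fin n)), g x - c ≤ f x) :
    ∃ C, ∀ x, g x - C ≤ f x := by
  obtain ⟨R, -, hR⟩ := eventually_cocompact_iff.1 h
  obtain ⟨C, hC⟩ := (isCompact_closedBall (0 : EuclideanSpace ℝ (Fin n))
    R).exists_bound_of_continuousOn (hg.sub hf).continuousOn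
  refine ⟨max c C, fun x => ?_⟩
  rcases le_total R ‖x‖ with hx | hx
  · have := hR x hx
    linarith [le_max_left c C]
  · have h1 := (le_abs_self _).trans (hC x (mem_closedBall_zero_iff.2 hx))
    simp only [Pi.sub_apply] at h1
    linarith [le_max_right c C]

/-- For ‖x‖ ≥ 1, log(1 + ‖x‖²) differs from 2 log ‖x‖ by a bounded amount and, unlike it, is
continuous at the origin; so the bound extends to all x. -/
theorem exists_forall_half_log_le {u : EuclideanSpace ℝ (Fin n) → ℝ} (hu : Continuous u) {β c : ℝ}
    (h : ∀ᶠ x in cocompact (EuclideanSpace ℝ (Fin n)), -β * Real.log ‖x‖ - c ≤ u x) :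
    ∃ C, ∀ x, -(β / 2) * Real.log (1 + ‖x‖ ^ 2) - C ≤ u x := by
  refine exists_forall_le_of_eventually_le (c := c + |β|) hu
    (continuous_const.mul (Continuous.log (by fun_prop) fun x => by positivity)) ?_
  obtain ⟨R, hR1, hR⟩ := eventually_cocompact_iff.1 h
  refine eventually_cocompact_iff.2 ⟨R, hR1, fun x hx => ?_⟩
  have hx1 : 1 ≤ ‖x‖ := hR1.trans hx
  have h1 : 2 * Real.log ‖x‖ ≤ Real.log (1 + ‖x‖ ^ 2) := by
    rw [show 2 * Real.log ‖x‖ = Real.log (‖x‖ ^ 2) by rw [Real.log_pow]; push_cast; ring]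
    exact Real.log_le_log (by positivity) (by linarith)
  have h2 : Real.log (1 + ‖x‖ ^ 2) ≤ 2 * Real.log ‖x‖ + 2 := by
    have h3 : Real.log (1 + ‖x‖ ^ 2) ≤ Real.log (2 * ‖x‖ ^ 2) :=
      Real.log_le_log (by positivity) (by nlinarith)
    rw [Real.log_mul (by norm_num) (by positivity), Real.log_pow] at h3
    have h4 := Real.log_two_lt_d9
    push_cast at h3
    linarith
  have h5 := hR x hx
  have h6 : -(β / 2) * (Real.log (1 + ‖x‖ ^ 2) - 2 * Real.log ‖x‖) ≤ |β| := by
    have h7 : -(β / 2) ≤ |β| / 2 := by linarith [neg_le_abs β]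
    nlinarith [abs_nonneg β]
  linarith

theorem exists_forall_neg_log_le {u : EuclideanSpace ℝ (Fin n) → ℝ} (hu : Continuous u) {β c : ℝ}
    (hβ : 0 ≤ β)
    (h : ∀ᶠ x in cocompact (EuclideanSpace ℝ (Fin n)), -β * Real.log ‖x‖ - c ≤ u x) :
    ∃ C, ∀ R, 1 ≤ R → ∀ x, ‖x‖ ≤ R → -β * Real.log R - C ≤ u x := by
  obtain ⟨C, hC⟩ := exists_forall_half_log_le hu h
  refine ⟨C + β, fun R hR x hx => ?_⟩
  have h3 : Real.log (1 + ‖x‖ ^ 2) ≤ Real.log (2 * R ^ 2) :=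
    Real.log_le_log (by positivity) (by nlinarith [norm_nonneg x])
  rw [Real.log_mul (by norm_num) (by positivity), Real.log_pow] at h3
  have h4 := Real.log_two_lt_d9
  push_cast at h3
  nlinarith [hC x]

/-- For β ≥ 0, averaging the lower bound over balls and comparing coefficients of log R suffices.
For β < 0, u would grow at least like a positive multiple of the logarithm, and its means could not
stay below M. -/
theorem le_of_eventually_neg_log_le (hn : 1 ≤ n) {u : EuclideanSpace ℝ (Fin n) → ℝ}
    (hu : Continuous u) {α M β c : ℝ}
    (hasym : Tendsto (fun R => wmean 1 u 0 R / Real.log R) atTop (𝓝 (-α * weightMass n)))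
    (hM : ∀ R, 0 ≤ R → wmean 1 u 0 R ≤ M)
    (h : ∀ᶠ x in cocompact (EuclideanSpace ℝ (Fin n)), -β * Real.log ‖x‖ - c ≤ u x) :
    α ≤ β := by
  have hμ := weightMass_pos hn
  have hconst : ∀ C : ℝ, Tendsto (fun R => C / Real.log R) atTop (𝓝 0) := fun C =>
    tendsto_const_nhds.div_atTop Real.tendsto_log_atTop
  rcases le_or_gt 0 β with hβ | hβ
  · obtain ⟨C, hC⟩ := exists_forall_neg_log_le hu hβ h
    have h1 : Tendsto (fun R => -β * weightMass n - C * weightMass n / Real.log R) atTop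
        (𝓝 (-β * weightMass n - 0)) := tendsto_const_nhds.sub (hconst _)
    have h2 := le_of_tendsto_of_tendsto h1 hasym (by
      filter_upwards [eventually_gt_atTop 1] with R hR
      have hl := Real.log_pos hR
      have h3 := le_wmean_of_le hu (by linarith : (0 : ℝ) ≤ R) (hC R hR.le)
      rw [le_div_iff₀ hl, sub_mul, div_mul_cancel₀ _ hl.ne']
      linarith)
    nlinarith
  · exfalso
    obtain ⟨C, hC⟩ := exists_forall_half_log_le hu h
    have hκ := weightMoment_pos hn
    have h1 : ∀ R, 1 ≤ R → -β * weightMoment n * Real.log R ≤ M + C * weightMass n := by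
      intro R hR
      have hlogc : Continuous fun x : EuclideanSpace ℝ (Fin n) => Real.log (1 + ‖x‖ ^ 2) :=
        Continuous.log (by fun_prop) fun x => by positivity
      have h2 : -(β / 2) * wmean 1 (fun x : EuclideanSpace ℝ (Fin n) => Real.log (1 + ‖x‖ ^ 2)) 0 R
          - C * weightMass n ≤ wmean 1 u 0 R := by
        have i1 := (integrable_wmean le_rfl hlogc (0 : EuclideanSpace ℝ (Fin n)) R).const_mul
          (-(β / 2))
        have i2 := (integrable_weight (n := n) (le_refl 1)).const_mul C
        rw [wmean, weightMass, ← integral_const_mul, ← integral_const_mul, ← integral_sub i1 i2]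
        refine integral_mono (i1.sub i2) (integrable_wmean le_rfl hu 0 R) fun y => ?_
        have := mul_le_mul_of_nonneg_right (hC (0 + R • y)) (weight_nonneg 1 y)
        simp only
        linarith
      have h3 := weightMoment_mul_log_le_wmean (n := n) hR
      have h4 := hM R (by linarith)
      nlinarith
    have h2 : Tendsto (fun R => -β * weightMoment n * Real.log R) atTop atTop :=
      Real.tendsto_log_atTop.const_mul_atTop (by nlinarith)
    obtain ⟨R, hR1, hR2⟩ := ((eventually_ge_atTop 1).and
      (h2.eventually_gt_atTop (M + C * weightMass n))).exists
    linarith [h1 R hR1]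

/-! ### Off-centre means and the sharp lower bound for u. -/

/-- For ‖z‖ < 2 the shift by e lowers the weight by at most 5/K, while the weight dilated by 3 is at
least 5/9 there; this is the source of 9/K. For ‖z‖ ≥ 2 the unshifted weight vanishes. -/
theorem weight_sub_ge {K : ℝ} (hK : 1 ≤ K) {e z : EuclideanSpace ℝ (Fin n)} (he : ‖e‖ = 1 / K) :
    0 ≤ weight 1 (z - e) - weight 1 z + 9 / K * weight 1 ((3 : ℝ)⁻¹ • z) := by
  have hK0 : 0 < K := by linarith
  have hK1 : 1 / K ≤ 1 := by rw [div_le_one hK0]; exact hK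
  have h9 : 0 ≤ 9 / K * weight 1 ((3 : ℝ)⁻¹ • z) := mul_nonneg (by positivity) (weight_nonneg _ _)
  rcases le_or_gt 2 ‖z‖ with hz | hz
  · have h1 : weight 1 z = 0 := weight_eq_zero le_rfl (by linarith)
    linarith [weight_nonneg 1 (z - e)]
  · have h1 : ‖z - e‖ ≤ ‖z‖ + 1 / K := he ▸ norm_sub_le z e
    have h2 : ‖z - e‖ ^ 2 ≤ ‖z‖ ^ 2 + 5 / K := by
      have h3 : ‖z - e‖ ^ 2 ≤ (‖z‖ + 1 / K) ^ 2 := pow_le_pow_left₀ (norm_nonneg _) h1 2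
      have h4 : 5 / K = 5 * (1 / K) := by ring
      have h5 : 0 < 1 / K := by positivity
      rw [h4]
      nlinarith
    have h3 : weight 1 z - 5 / K ≤ weight 1 (z - e) := by
      simp only [weight, pow_one]
      have h5 : 0 < 5 / K := by positivity
      rw [sub_le_iff_le_add]
      refine max_le (by linarith [le_max_left 0 (1 - ‖z - e‖ ^ 2)]) ?_
      linarith [le_max_right 0 (1 - ‖z - e‖ ^ 2)]
    have h4 : 5 / 9 ≤ weight 1 ((3 : ℝ)⁻¹ • z) := by
      simp only [weight, pow_one, norm_smul]
      refine le_trans ?_ (le_max_right _ _)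
      norm_num
      nlinarith [norm_nonneg z]
    have h5 : 5 / K ≤ 9 / K * weight 1 ((3 : ℝ)⁻¹ • z) := by
      calc 5 / K = 9 / K * (5 / 9) := by ring
        _ ≤ _ := by gcongr
    linarith

theorem wmean_eq_integral_sub (f : EuclideanSpace ℝ (Fin n) → ℝ) (x : EuclideanSpace ℝ (Fin n))
    {ρ : ℝ} (hρ : ρ ≠ 0) : wmean 1 f x ρ = ∫ z, f (ρ • z) * weight 1 (z - ρ⁻¹ • x) := by
  rw [wmean, ← integral_sub_right_eq_self (fun y => f (x + ρ • y) * weight 1 y) (ρ⁻¹ • x)]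
  congr 1
  ext z
  rw [smul_sub, smul_inv_smul₀ hρ, add_sub_cancel]

theorem integral_mul_weight_third (f : EuclideanSpace ℝ (Fin n) → ℝ) (ρ : ℝ) :
    ∫ z, f (ρ • z) * weight 1 ((3 : ℝ)⁻¹ • z) = 3 ^ n * wmean 1 f 0 (3 * ρ) := by
  have h := Measure.integral_comp_smul_of_nonneg (volume : Measure (EuclideanSpace ℝ (Fin n)))
    (fun z => f (ρ • z) * weight 1 ((3 : ℝ)⁻¹ • z)) 3 (hR := by norm_num)
  simp only [inv_smul_smul₀ (three_ne_zero : (3 : ℝ) ≠ 0), finrank_euclideanSpace_fin,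
    smul_eq_mul, smul_smul] at h
  simp only [wmean, zero_add, mul_comm 3 ρ]
  rw [h, mul_inv_cancel_left₀ (by positivity)]

/-- Comparison of the means of `f` over off-centre and centred balls. -/
theorem wmean_zero_le_wmean_add {f : EuclideanSpace ℝ (Fin n) → ℝ} (hf : Continuous f) {K b : ℝ}
    (hK : 1 ≤ K) {x : EuclideanSpace ℝ (Fin n)} (hx : x ≠ 0)
    (hb : ∀ y, ‖y‖ ≤ 3 * (K * ‖x‖) → 0 ≤ f y + b) :
    wmean 1 f 0 (K * ‖x‖) ≤ wmean 1 f x (K * ‖x‖)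
      + 9 / K * 3 ^ n * (wmean 1 f 0 (3 * (K * ‖x‖)) + b * weightMass n) := by
  have hx0 : 0 < ‖x‖ := norm_pos_iff.2 hx
  have hK0 : 0 < K := by linarith
  set ρ := K * ‖x‖ with hρdef
  have hρ : 0 < ρ := by positivity
  set e := ρ⁻¹ • x with hedef
  have he : ‖e‖ = 1 / K := by
    rw [hedef, norm_smul, Real.norm_of_nonneg (by positivity), hρdef]
    field_simp
  have hadd : ∀ (x : EuclideanSpace ℝ (Fin n)) (r : ℝ),
      wmean 1 (fun y => f y + b) x r = wmean 1 f x r + b * weightMass n := fun x r => by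
    simp only [wmean, weightMass, add_mul]
    rw [integral_add (integrable_wmean le_rfl hf x r) ((integrable_weight le_rfl).const_mul b),
      integral_const_mul]
  have hv : Continuous fun z => f (ρ • z) + b := by fun_prop
  have hs1 : HasCompactSupport fun z : EuclideanSpace ℝ (Fin n) => weight 1 (z - e) :=
    HasCompactSupport.intro (isCompact_closedBall e 1) fun z hz =>
      weight_eq_zero le_rfl (by
        rw [mem_closedBall_iff_norm, not_le] at hz
        exact hz.le)
  have hs3 : HasCompactSupport fun z : EuclideanSpace ℝ (Fin n) => weight 1 ((3 : ℝ)⁻¹ • z) :=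
    HasCompactSupport.intro (isCompact_closedBall 0 3) fun z hz =>
      weight_eq_zero le_rfl (by
        rw [mem_closedBall_zero_iff, not_le] at hz
        rw [norm_smul]
        norm_num
        linarith)
  have hc1 : Continuous fun z : EuclideanSpace ℝ (Fin n) => weight 1 (z - e) :=
    (continuous_weight 1).comp (by fun_prop)
  have hc3 : Continuous fun z : EuclideanSpace ℝ (Fin n) => weight 1 ((3 : ℝ)⁻¹ • z) :=
    (continuous_weight 1).comp (by fun_prop)
  have i1 : Integrable fun z => (f (ρ • z) + b) * weight 1 (z - e) :=
    (hv.mul hc1).integrable_of_hasCompactSupport (μ := volume) hs1.mul_left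
  have i2 := integrable_mul_weight (le_refl 1) hv
  have i3 : Integrable fun z => 9 / K * ((f (ρ • z) + b) * weight 1 ((3 : ℝ)⁻¹ • z)) :=
    ((hv.mul hc3).integrable_of_hasCompactSupport (μ := volume) hs3.mul_left).const_mul (9 / K)
  have hnonneg : 0 ≤ ∫ z, ((f (ρ • z) + b) * weight 1 (z - e) - (f (ρ • z) + b) * weight 1 z
      + 9 / K * ((f (ρ • z) + b) * weight 1 ((3 : ℝ)⁻¹ • z))) := by
    refine integral_nonneg fun z => ?_
    have h1 := weight_sub_ge hK he (z := z)
    have h2 : (f (ρ • z) + b) * weight 1 (z - e) - (f (ρ • z) + b) * weight 1 z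
        + 9 / K * ((f (ρ • z) + b) * weight 1 ((3 : ℝ)⁻¹ • z))
        = (f (ρ • z) + b) *
          (weight 1 (z - e) - weight 1 z + 9 / K * weight 1 ((3 : ℝ)⁻¹ • z)) := by ring
    simp only [Pi.zero_apply]
    rw [h2]
    -- Positivity of f + b is known only on the ball of radius 3ρ; for ‖z‖ > 3 all three weights
    -- vanish.
    rcases le_or_gt ‖z‖ 3 with hz | hz
    · refine mul_nonneg (hb _ ?_) h1
      rw [norm_smul, Real.norm_of_nonneg hρ.le]
      nlinarith
    · have w1 : weight 1 z = 0 := weight_eq_zero le_rfl (by linarith)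
      have w2 : weight 1 ((3 : ℝ)⁻¹ • z) = 0 := weight_eq_zero le_rfl (by
        rw [norm_smul]
        norm_num
        linarith)
      have w3 : weight 1 (z - e) = 0 := weight_eq_zero le_rfl (by
        have h3 := norm_sub_norm_le z e
        have h4 : 1 / K ≤ 1 := by rw [div_le_one hK0]; exact hK
        linarith)
      simp [w1, w2, w3]
  have i12 : Integrable fun z =>
      (f (ρ • z) + b) * weight 1 (z - e) - (f (ρ • z) + b) * weight 1 z := i1.sub i2
  rw [integral_add i12 i3, integral_sub i1 i2, integral_const_mul,
    ← wmean_eq_integral_sub (fun y => f y + b) x hρ.ne',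
    integral_mul_weight_third (fun y => f y + b)] at hnonneg
  have h0 : ∫ z, (f (ρ • z) + b) * weight 1 z = wmean 1 (fun y => f y + b) 0 ρ := by
    simp [wmean]
  rw [h0, hadd, hadd, hadd] at hnonneg
  linarith

/-- The mean over the ball of centre x and radius K‖x‖ bounds u(x) below, and
`wmean_zero_le_wmean_add` bounds that mean below by the centred one, with a loss of order (log
‖x‖)/K. -/
theorem eventually_neg_log_le (hn : 1 ≤ n) {u : EuclideanSpace ℝ (Fin n) → ℝ}
    (hu : Continuous u) {α M A C : ℝ}
    (hasym : Tendsto (fun R => wmean 1 u 0 R / Real.log R) atTop (𝓝 (-α * weightMass n)))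
    (hM : ∀ R, 0 ≤ R → wmean 1 u 0 R ≤ M)
    (hA : ∀ x R, 0 ≤ R → wmean 1 u x R ≤ (u x + A) * weightMass n)
    (hC : ∀ R, 1 ≤ R → ∀ x, ‖x‖ ≤ R → -2 * Real.log R - C ≤ u x) {ε : ℝ} (hε : 0 < ε) :
    ∀ᶠ x in cocompact (EuclideanSpace ℝ (Fin n)), -(α + ε) * Real.log ‖x‖ ≤ u x := by
  have hμ := weightMass_pos hn
  set μ := weightMass n
  -- Chosen so that 2κ = 18·3ⁿ/K < ε; the 2 is the coefficient in the a priori bound u ≥ -2 log R -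
  -- C.
  set K : ℝ := 18 * 3 ^ n / ε + 1
  have hK : 1 ≤ K := le_add_of_nonneg_left (by positivity)
  have hK0 : 0 < K := by linarith
  set κ : ℝ := 9 / K * 3 ^ n with hκdef
  have hκ : 2 * κ < ε := by
    have h1 : ε * K = 18 * 3 ^ n + ε := by
      simp only [K]
      field_simp
    rw [hκdef, show 2 * (9 / K * 3 ^ n) = 18 * 3 ^ n / K by ring, div_lt_iff₀ hK0]
    linarith
  have hκ0 : 0 ≤ κ := by positivity
  have hlog : ∀ c : ℝ, 0 < c →
      Tendsto (fun r => Real.log (c * r) / Real.log r) atTop (𝓝 1) := fun c hc => by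
    have h1 : Tendsto (fun r => Real.log c / Real.log r + 1) atTop (𝓝 (0 + 1)) :=
      (tendsto_const_nhds.div_atTop Real.tendsto_log_atTop).add_const 1
    rw [zero_add] at h1
    refine h1.congr' ?_
    filter_upwards [eventually_gt_atTop 1] with r hr
    have := Real.log_pos hr
    rw [Real.log_mul hc.ne' (by positivity)]
    field_simp
  have h1 : Tendsto (fun r => wmean 1 u 0 (K * r) / Real.log r) atTop (𝓝 (-α * μ)) := by
    have h2 := (hasym.comp (tendsto_id.const_mul_atTop hK0)).mul (hlog K hK0)
    rw [mul_one] at h2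
    refine h2.congr' ?_
    filter_upwards [eventually_gt_atTop 1] with r hr
    have h3 : Real.log (K * r) ≠ 0 := (Real.log_pos (by nlinarith)).ne'
    simp only [Function.comp, id]
    field_simp
  -- The resulting lower bound for u at norm r, with shift b = 2 log(3Kr) + C making u + b
  -- nonnegative on the ball of radius 3Kr.
  set G : ℝ → ℝ := fun r =>
    wmean 1 u 0 (K * r) / μ - κ * (M / μ + (2 * Real.log (3 * K * r) + C)) - A with hG
  have hGlim : Tendsto (fun r => G r / Real.log r) atTop (𝓝 (-α - 2 * κ)) := by
    have h2 : Tendsto (fun r => wmean 1 u 0 (K * r) / Real.log r / μ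
        - 2 * κ * (Real.log (3 * K * r) / Real.log r) - (κ * (M / μ + C) + A) / Real.log r) atTop
        (𝓝 (-α * μ / μ - 2 * κ * 1 - 0)) :=
      ((h1.div_const μ).sub ((hlog (3 * K) (by positivity)).const_mul (2 * κ))).sub
        (tendsto_const_nhds.div_atTop Real.tendsto_log_atTop)
    rw [mul_div_cancel_right₀ _ hμ.ne', mul_one, sub_zero] at h2
    refine h2.congr fun r => ?_
    simp only [hG]
    ring
  have hev : ∀ᶠ r in atTop, -(α + ε) * Real.log r ≤ G r := by
    filter_upwards [hGlim.eventually_const_lt (show -(α + ε) < -α - 2 * κ by linarith),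
      eventually_gt_atTop 1] with r h2 h3
    exact ((lt_div_iff₀ (Real.log_pos h3)).1 h2).le
  filter_upwards [tendsto_norm_cocompact_atTop.eventually
    (hev.and (eventually_gt_atTop 1))] with x hx
  refine hx.1.trans ?_
  have hx1 : 1 < ‖x‖ := hx.2
  have hKx : 1 ≤ K * ‖x‖ := by nlinarith
  have h2 := wmean_zero_le_wmean_add hu hK (norm_pos_iff.1 (by linarith : 0 < ‖x‖))
    (b := 2 * Real.log (3 * (K * ‖x‖)) + C) fun y hy => by
      have := hC (3 * (K * ‖x‖)) (by linarith) y hy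
      linarith
  have h3 := hA x (K * ‖x‖) (by linarith)
  have h4 := hM (3 * (K * ‖x‖)) (by linarith)
  have h5 := mul_le_mul_of_nonneg_left
    (add_le_add_left h4 ((2 * Real.log (3 * (K * ‖x‖)) + C) * μ)) hκ0
  have h6 : G ‖x‖ * μ = wmean 1 u 0 (K * ‖x‖)
      - κ * (M + (2 * Real.log (3 * (K * ‖x‖)) + C) * μ) - A * μ := by
    simp only [hG, mul_assoc 3 K]
    field_simp
  refine le_of_mul_le_mul_right ?_ hμ
  rw [h6]
  linarith

/-! ### Consequence of slow decay of the Laplacian. -/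

theorem laplacian_log_le (x : EuclideanSpace ℝ (Fin n)) (hx : x ≠ 0) :
    Δ (fun y : EuclideanSpace ℝ (Fin n) => Real.log (1 + ‖y‖ ^ 2)) x ≤ 2 * n / ‖x‖ ^ 2 := by
  have hd : ∀ s : ℝ, 1 + s ≠ 0 → HasDerivAt (fun s : ℝ => Real.log (1 + s)) ((1 + s)⁻¹) s :=
    fun s hs => by
      simpa using ((hasDerivAt_id s).const_add 1).log hs
  have hd2 : ∀ s : ℝ, 1 + s ≠ 0 → HasDerivAt (fun s : ℝ => (1 + s)⁻¹) (-((1 + s) ^ 2)⁻¹) s :=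
    fun s hs => by
      simpa [neg_div] using ((hasDerivAt_id s).const_add 1).fun_inv hs
  have h0 : (1 : ℝ) + ‖x‖ ^ 2 ≠ 0 := by positivity
  have hx2 : 0 < ‖x‖ ^ 2 := by positivity
  have h := laplacian_radial (n := n) (x := x) (g := fun s => Real.log (1 + s))
    (g₁ := fun s => (1 + s)⁻¹) ((contDiffAt_const.add contDiffAt_id).log h0)
    (by
      filter_upwards [lt_mem_nhds (show (-1 : ℝ) < ‖x‖ ^ 2 by linarith)] with s hs
      exact hd s (by linarith)) (hd2 _ h0)
  rw [h]
  have h1 : 0 ≤ 4 * ‖x‖ ^ 2 * ((1 + ‖x‖ ^ 2) ^ 2)⁻¹ := by positivity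
  have h2 : 2 * n * (1 + ‖x‖ ^ 2)⁻¹ ≤ 2 * n / ‖x‖ ^ 2 := by
    rw [← div_eq_mul_inv]
    gcongr
    linarith
  linarith

/-- If `-Δu` decays slower than `‖x‖⁻²`, then the means of `u` tend to `-∞` faster than any
multiple of the logarithm. -/
theorem not_tendsto_of_laplacian_le (hn : 4 ≤ n) {u : EuclideanSpace ℝ (Fin n) → ℝ}
    (hu : ContDiff ℝ ∞ u) {L : ℝ}
    (hΔ : ∀ N : ℝ, ∀ᶠ x in cocompact (EuclideanSpace ℝ (Fin n)), Δ u x ≤ -(N / ‖x‖ ^ 2)) :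
    ¬ Tendsto (fun R => wmean 1 u 0 R / Real.log R) atTop (𝓝 L) := by
  intro hL
  have hκ := weightMoment_pos (n := n) (by omega)
  set κ := weightMoment n
  -- With this N, superharmonicity of u + N log(1 + ‖x‖²) near infinity yields L ≤ -2κN ≤ L - 1.
  set N := max 0 ((1 - L) / (2 * κ)) with hN
  have hN0 : 0 ≤ N := le_max_left _ _
  have hNL : 1 - L ≤ N * (2 * κ) := (div_le_iff₀ (by positivity)).1 (le_max_right _ _)
  set ℓ : EuclideanSpace ℝ (Fin n) → ℝ := fun y => Real.log (1 + ‖y‖ ^ 2)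
  have hℓ : ContDiff ℝ ∞ ℓ := (contDiff_const.add (contDiff_norm_sq ℝ)).log fun x => by positivity
  have hf : ContDiff ℝ ∞ (fun y => u y + N * ℓ y) := hu.add (contDiff_const.mul hℓ)
  have hfΔ : ∀ᶠ x in cocompact (EuclideanSpace ℝ (Fin n)), Δ (fun y => u y + N * ℓ y) x ≤ 0 := by
    have hne : ∀ᶠ x in cocompact (EuclideanSpace ℝ (Fin n)), x ≠ 0 :=
      (tendsto_norm_cocompact_atTop.eventually (eventually_gt_atTop 0)).mono fun x hx =>
        norm_pos_iff.1 hx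
    filter_upwards [hΔ (N * (2 * n)), hne] with x hx hx0
    have hNℓ : ContDiffAt ℝ 2 (N • ℓ) x := (contDiff_two hℓ).contDiffAt.const_smul N
    change Δ (u + N • ℓ) x ≤ 0
    rw [(contDiff_two hu).contDiffAt.laplacian_add hNℓ,
      InnerProductSpace.laplacian_smul _ (contDiff_two hℓ).contDiffAt, smul_eq_mul]
    have h1 := mul_le_mul_of_nonneg_left (laplacian_log_le x hx0) hN0
    rw [← mul_div_assoc] at h1
    linarith
  obtain ⟨A, hA⟩ := exists_wmean_le hn hf hfΔ
  set M := (u 0 + N * ℓ 0 + A) * weightMass n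
  have h1 : Tendsto (fun R => M / Real.log R - N * (2 * κ)) atTop (𝓝 (0 - N * (2 * κ))) :=
    (tendsto_const_nhds.div_atTop Real.tendsto_log_atTop).sub_const _
  have h2 := le_of_tendsto_of_tendsto hL h1 (by
    filter_upwards [eventually_gt_atTop 1] with R hR
    have hl := Real.log_pos hR
    have h3 : wmean 1 (fun y => u y + N * ℓ y) 0 R ≤ M := hA 0 R (by linarith)
    have h4 : wmean 1 (fun y => u y + N * ℓ y) 0 R = wmean 1 u 0 R + N * wmean 1 ℓ 0 R := by
      simp only [wmean, add_mul, mul_assoc]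
      rw [integral_add (integrable_wmean le_rfl hu.continuous 0 R)
        ((integrable_wmean le_rfl hℓ.continuous 0 R).const_mul N), integral_const_mul]
    have h5 := mul_le_mul_of_nonneg_left (weightMoment_mul_log_le_wmean (n := n) hR.le) hN0
    rw [div_le_iff₀ hl, sub_mul, div_mul_cancel₀ _ hl.ne']
    have h6 : N * (weightMoment n * (2 * Real.log R)) = N * (2 * κ) * Real.log R := by ring
    rw [h4] at h3
    rw [h6] at h5
    linarith)
  linarith

/-! ### Assembly: bounds on α, the liminf, and slowly decaying curvature. -/

/-- The consequences of nonnegative scalar curvature near infinity. -/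
theorem asymptotics_of_scalarCurvature_nonneg (hn : 4 ≤ n) (hn_even : Even n)
    {u : EuclideanSpace ℝ (Fin n) → ℝ} (hu : ContDiff ℝ ∞ u) (hQ : Integrable (qDensity u))
    (hR : ∀ᶠ x in cocompact (EuclideanSpace ℝ (Fin n)),
      0 ≤ scalarCurvature (conformalMetric u) x) :
    Tendsto (fun R => wmean 1 u 0 R / Real.log R) atTop (𝓝 (-alphaQ u * weightMass n)) ∧
    0 ≤ alphaQ u ∧ alphaQ u ≤ 2 ∧
    (∀ β, (∀ᶠ x in cocompact (EuclideanSpace ℝ (Fin n)), -β * Real.log ‖x‖ ≤ u x) →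
      alphaQ u ≤ β) ∧
    ∀ ε > 0, ∀ᶠ x in cocompact (EuclideanSpace ℝ (Fin n)),
      -(alphaQ u + ε) * Real.log ‖x‖ ≤ u x := by
  have hμ := weightMass_pos (n := n) (by omega)
  obtain ⟨c, hc⟩ := exists_neg_two_log_le hn hn_even hu hR
  obtain ⟨C, hC⟩ := exists_forall_neg_log_le hu.continuous (by norm_num) hc
  obtain ⟨A, hA⟩ := exists_wmean_le hn hu (hR.mono fun x hx => by
    have h1 := laplacian_add_grad_sq_le_of_le_scalarCurvature hn hu hx
    have h2 := grad_sq_nonneg hn u x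
    simp only [zero_mul, zero_div, neg_zero] at h1
    linarith)
  set M := (u 0 + A) * weightMass n
  have hM : ∀ R, 0 ≤ R → wmean 1 u 0 R ≤ M := fun R hR => hA 0 R hR
  -- Superharmonicity bounds the means above by a constant and u ≥ -2 log R - C bounds them below;
  -- this excludes a nonconstant polynomial part.
  have hbd : ∀ᶠ R in atTop, |wmean 1 u 0 R| ≤
      (|M| + 2 * weightMass n + |C| * weightMass n) * Real.log R := by
    filter_upwards [Real.tendsto_log_atTop.eventually_ge_atTop 1, eventually_ge_atTop 1]
      with R h1 h2
    have h3 := le_wmean_of_le hu.continuous (by linarith : (0 : ℝ) ≤ R) (hC R h2)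
    have h4 := hM R (by linarith)
    have h5 : |M| ≤ |M| * Real.log R := le_mul_of_one_le_right (abs_nonneg M) h1
    have h6 : 0 ≤ |C| * weightMass n := by positivity
    have h7 : |C| * weightMass n ≤ |C| * weightMass n * Real.log R := le_mul_of_one_le_right h6 h1
    have h8 : C * weightMass n ≤ |C| * weightMass n := by gcongr; exact le_abs_self C
    have h9 : 0 ≤ 2 * weightMass n * Real.log R := by positivity
    have h10 := le_abs_self M
    have h11 := abs_nonneg M
    rw [abs_le]
    constructor <;> nlinarith
  have hasym := tendsto_wmean_div_log hn hn_even hu hQ hbd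
  refine ⟨hasym, ?_, ?_, fun β hβ => ?_, fun ε hε => ?_⟩
  · have h1 : Tendsto (fun R => M / Real.log R) atTop (𝓝 0) :=
      tendsto_const_nhds.div_atTop Real.tendsto_log_atTop
    have h2 := le_of_tendsto_of_tendsto hasym h1 (by
      filter_upwards [eventually_gt_atTop 1] with R hR
      have hl := Real.log_pos hR
      have := hM R (by linarith)
      gcongr)
    nlinarith
  · exact le_of_eventually_neg_log_le (by omega) hu.continuous hasym hM hc
  · exact le_of_eventually_neg_log_le (c := 0) (by omega) hu.continuous hasym hM
      (by simpa using hβ)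
  · exact eventually_neg_log_le (by omega) hu.continuous hasym hM hA hC hε

/-- A real c strictly between -α and the liminf would give u ≥ c log ‖x‖ near infinity, hence α ≤
-c, which is absurd. The other inequality is `h2`. -/
theorem liminf_div_log_eq {u : EuclideanSpace ℝ (Fin n) → ℝ} {α : ℝ}
    (h1 : ∀ β, (∀ᶠ x in cocompact (EuclideanSpace ℝ (Fin n)), -β * Real.log ‖x‖ ≤ u x) → α ≤ β)
    (h2 : ∀ ε > 0, ∀ᶠ x in cocompact (EuclideanSpace ℝ (Fin n)),
      -(α + ε) * Real.log ‖x‖ ≤ u x) :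
    liminf (fun x : EuclideanSpace ℝ (Fin n) => ((u x / Real.log ‖x‖ : ℝ) : EReal))
      (cocompact (EuclideanSpace ℝ (Fin n))) = ((-α : ℝ) : EReal) := by
  have hlog : ∀ᶠ x in cocompact (EuclideanSpace ℝ (Fin n)), 0 < Real.log ‖x‖ :=
    (Real.tendsto_log_atTop.comp tendsto_norm_cocompact_atTop).eventually_gt_atTop 0
  refine le_antisymm ?_ ?_
  · by_contra! hlt
    obtain ⟨c, hc1, hc2⟩ := EReal.lt_iff_exists_real_btwn.1 hlt
    have hev := eventually_lt_of_lt_liminf hc2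
    have := h1 (-c) (by
      filter_upwards [hev, hlog] with x hx hl
      rw [neg_neg]
      exact ((lt_div_iff₀ hl).1 (EReal.coe_lt_coe_iff.1 hx)).le)
    have h3 := EReal.coe_lt_coe_iff.1 hc1
    linarith
  · refine le_of_forall_lt fun c hc => ?_
    obtain ⟨d, hd1, hd2⟩ := EReal.lt_iff_exists_real_btwn.1 hc
    refine hd1.trans_le (le_liminf_of_le (by isBoundedDefault) ?_)
    have h3 := EReal.coe_lt_coe_iff.1 hd2
    filter_upwards [h2 (-α - d) (by linarith), hlog] with x hx hl
    rw [EReal.coe_le_coe_iff, le_div_iff₀ hl]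
    rwa [show -(α + (-α - d)) = d by ring] at hx

/-- Lower bound for the total Q-curvature under slow decay of the scalar curvature. -/
theorem one_sub_half_le_alphaQ (hn : 4 ≤ n) {u : EuclideanSpace ℝ (Fin n) → ℝ}
    (hu : ContDiff ℝ ∞ u) {α L C p : ℝ} (hC : 0 < C)
    (hasym : Tendsto (fun R => wmean 1 u 0 R / Real.log R) atTop (𝓝 L))
    (h2 : ∀ ε > 0, ∀ᶠ x in cocompact (EuclideanSpace ℝ (Fin n)),
      -(α + ε) * Real.log ‖x‖ ≤ u x)
    (hR : ∀ᶠ x in cocompact (EuclideanSpace ℝ (Fin n)),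
      C * ‖x‖ ^ (-p) ≤ scalarCurvature (conformalMetric u) x) :
    1 - p / 2 ≤ α := by
  by_contra! hlt
  -- Half the gap: then -p - 2(α + ε) = -2 + 2ε, so the lower bound for -Δu beats every N‖x‖⁻².
  set ε := (1 - p / 2 - α) / 2 with hε
  have hε0 : 0 < ε := by rw [hε]; linarith
  have hn' : (4 : ℝ) ≤ n := by exact_mod_cast hn
  set C' := C / (2 * (n - 1)) with hC'
  have hC'0 : 0 < C' := div_pos hC (by linarith)
  refine not_tendsto_of_laplacian_le hn hu (fun N => ?_) hasym
  have hgrow : Tendsto (fun x : EuclideanSpace ℝ (Fin n) => C' * Real.exp (2 * ε * Real.log ‖x‖))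
      (cocompact _) atTop :=
    (Real.tendsto_exp_atTop.comp ((Real.tendsto_log_atTop.comp
      tendsto_norm_cocompact_atTop).const_mul_atTop (by positivity))).const_mul_atTop hC'0
  filter_upwards [hR, h2 ε hε0, hgrow.eventually_ge_atTop N,
    tendsto_norm_cocompact_atTop.eventually (eventually_gt_atTop 0)] with x h3 h4 h5 h6
  have h7 := laplacian_add_grad_sq_le_of_le_scalarCurvature hn hu h3
  have h8 := grad_sq_nonneg hn u x
  have h9 : Real.exp (2 * ε * Real.log ‖x‖) / ‖x‖ ^ 2 ≤ ‖x‖ ^ (-p) * Real.exp (2 * u x) := by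
    rw [Real.rpow_def_of_pos h6, ← Real.exp_add,
      show ‖x‖ ^ 2 = Real.exp (2 * Real.log ‖x‖) by
        rw [mul_comm, Real.exp_mul, Real.exp_log h6]; norm_num, ← Real.exp_sub]
    refine Real.exp_le_exp.2 ?_
    have h10 : α = 1 - p / 2 - 2 * ε := by rw [hε]; ring
    rw [h10] at h4
    linarith
  have h10 := mul_le_mul_of_nonneg_left h9 hC'0.le
  have h11 : N / ‖x‖ ^ 2 ≤ C' * (Real.exp (2 * ε * Real.log ‖x‖) / ‖x‖ ^ 2) := by
    rw [← mul_div_assoc]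
    gcongr
  have h12 : C * ‖x‖ ^ (-p) * Real.exp (2 * u x) / (2 * (n - 1))
      = C' * (‖x‖ ^ (-p) * Real.exp (2 * u x)) := by rw [hC']; ring
  linarith

theorem factorial_mul_sphereVolume_pos (hn : 4 ≤ n) (hn_even : Even n) :
    0 < ((n - 1)! : ℝ) * sphereVolume n := by
  obtain ⟨m, rfl⟩ : ∃ m, n = 2 * m := hn_even.exists_two_nsmul _ |>.imp fun m h => by simpa using h
  rw [factorial_mul_sphereVolume (by omega)]
  positivity

end ConformalQ

theorem mainTheorem2 (n : ℕ) (hn : 4 ≤ n) (hn_even : Even n)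
    (u : EuclideanSpace ℝ (Fin n) → ℝ) (hu : ContDiff ℝ ∞ u)
    (hQ : Integrable (ConformalQ.qDensity u) volume) :
    ((∀ᶠ x in cocompact (EuclideanSpace ℝ (Fin n)),
        0 ≤ ConformalQ.scalarCurvature (ConformalQ.conformalMetric u) x) →
      (0 ≤ (∫ x, ConformalQ.qDensity u x) ∧
        (∫ x, ConformalQ.qDensity u x) ≤ ((n - 1)! : ℝ) * ConformalQ.sphereVolume n) ∧
      liminf (fun x : EuclideanSpace ℝ (Fin n) => ((u x / Real.log ‖x‖ : ℝ) : EReal))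
          (cocompact (EuclideanSpace ℝ (Fin n))) =
        ((-(2 / (((n - 1)! : ℝ) * ConformalQ.sphereVolume n)
            * (∫ x, ConformalQ.qDensity u x)) : ℝ) : EReal)) ∧
    (∀ C p : ℝ, 0 < C → -2 ≤ p →
      (∀ᶠ x in cocompact (EuclideanSpace ℝ (Fin n)),
        C * ‖x‖ ^ (-p) ≤ ConformalQ.scalarCurvature (ConformalQ.conformalMetric u) x) →
      ((n - 1)! : ℝ) * ConformalQ.sphereVolume n / 2 * max 0 (1 - p / 2)
          ≤ (∫ x, ConformalQ.qDensity u x) ∧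
        (∫ x, ConformalQ.qDensity u x) ≤ ((n - 1)! : ℝ) * ConformalQ.sphereVolume n) := by
  have hV := ConformalQ.factorial_mul_sphereVolume_pos hn hn_even
  have hI : ∫ x, ConformalQ.qDensity u x
      = ((n - 1)! : ℝ) * ConformalQ.sphereVolume n / 2 * ConformalQ.alphaQ u := by
    rw [ConformalQ.alphaQ]
    generalize ((n - 1)! : ℝ) * ConformalQ.sphereVolume n = V at hV
    field_simp
  constructor
  · intro hR
    obtain ⟨-, h0, h2, hle, hge⟩ :=
      ConformalQ.asymptotics_of_scalarCurvature_nonneg hn hn_even hu hQ hR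
    refine ⟨⟨?_, ?_⟩, ConformalQ.liminf_div_log_eq hle hge⟩
    · rw [hI]
      positivity
    · rw [hI]
      nlinarith
  · intro C p hC _ hR
    obtain ⟨hasym, h0, h2, -, hge⟩ :=
      ConformalQ.asymptotics_of_scalarCurvature_nonneg hn hn_even hu hQ
        (hR.mono fun x hx => le_trans (by positivity) hx)
    have hp := ConformalQ.one_sub_half_le_alphaQ hn hu hC hasym hge hR
    constructor
    · rw [hI]
      exact mul_le_mul_of_nonneg_left (max_le h0 hp) (by positivity)
    · rw [hI]
      nlinarith
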